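/- Let $(\Omega,\mathcal F,\mathbb P)$ be a probability space carrying a random set $\Pi(\omega)\subseteq\{2,3,4,\dots\}$ (the Cramér quasi-primes) such that $2,3\in\Pi(\omega)$ for all $\omega$, and the events $\{n\in\Pi(\omega)\}$, $n\ge 4$, are independent with $\mathbb P(n\in\Pi(\omega))=\frac{1}{\ln n}$. For $\operatorname{Re}s>1$ put $$\zeta(s,\omega)=\prod_{p\in\Pi(\omega)}\frac{1}{1-p^{-s}},$$ where the product converges $\mathbb P$-a.s. for all $s$ with $\operatorname{Re}s>1$. (a) $\mathbb P$-a.s., $\zeta(\cdot,\omega)$ has an analytic continuation to $\{\operatorname{Re}s>1/2\}\setminus\{1\}$, and the singularity at $s=1$ is a simple pole. (b) For every fixed $t\in\mathbb R$, the continued function satisfies $\limsup_{\sigma\to1/2^+}|\zeta(\sigma+it,\omega)|=\infty$ $\mathbb P$-a.s. Consequently, $\mathbb P$-a.s., the function cannot be continued analytically through the critical line: for no point $s_0$ with $\operatorname{Re}s_0=1/2$ is there a function analytic in a neighbourhood of $s_0$ that coincides with $\zeta(\cdot,\omega)$ at the points $s$ of that neighbourhood with $\operatorname{Re}s>1/2$.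 -/

import Mathlib

open Filter Topology MeasureTheory ProbabilityTheory

noncomputable section

/-- `Q ω` is the random set of Cramér quasi-primes: `2` and `3` always belong to it, nothing below
`2` does, and each `n ≥ 4` belongs to it with probability `1 / ln n`, independently over `n`. -/
structure IsCramerQuasiPrimes {Ω : Type*} [MeasurableSpace Ω] (P : Measure Ω)
    (Q : Ω → Set ℕ) : Prop where
  measurableSet_mem : ∀ n : ℕ, MeasurableSet {ω | n ∈ Q ω}
  two_le : ∀ ω, ∀ n ∈ Q ω, 2 ≤ n
  two_mem : ∀ ω, 2 ∈ Q ω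
  three_mem : ∀ ω, 3 ∈ Q ω
  prob_mem : ∀ n : ℕ, 4 ≤ n → P {ω | n ∈ Q ω} = ENNReal.ofReal (1 / Real.log n)
  indep : iIndepSet (fun n : {n : ℕ // 4 ≤ n} => {ω | (n : ℕ) ∈ Q ω}) P

/-- The factor `1 / (1 - 1 / p ^ s)` of the Euler product. -/
def eulerFactor (s : ℂ) (p : ℕ) : ℂ := 1 / (1 - 1 / (p : ℂ) ^ s)

/-- The Euler product over the set `A` of natural numbers. -/
def eulerZeta (A : Set ℕ) (s : ℂ) : ℂ := ∏' p : A, eulerFactor s p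

/-- `F` is an analytic continuation of the Euler product over `A` from `Re s > 1` to `Re s > 1/2`,
whose only singularity there is a simple pole at `s = 1`. -/
structure IsZetaContinuation (A : Set ℕ) (F : ℂ → ℂ) : Prop where
  eq_eulerZeta : ∀ s : ℂ, 1 < s.re → F s = eulerZeta A s
  analyticOnNhd : AnalyticOnNhd ℂ F ({s : ℂ | 1 / 2 < s.re} \ {1})
  meromorphicAt_one : MeromorphicAt F 1
  order_one : meromorphicOrderAt F 1 = ((-1 : ℤ) : WithTop ℤ)

end

/-!
The logarithm of the Euler product over a set `A` splits, for `Re s > 1`, into the sums over `n ∈ A`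
of `n ^ (-s)`, of `n ^ (-2 s) / 2`, and of a remainder of order `n ^ (-3 s)`, which converges
absolutely beyond the critical line (`hasProd_eulerFactor`). Writing the indicator of `n ∈ Q ω` as
its probability `density n` plus a centred variable `centered (Q ω) n`, the first sum becomes
`densitySeries s + V s`, where `V` is the random Dirichlet series of the centred variables.

The derivative of `densitySeries = ∑ density n * n ^ (-s)` is `-ζ` up to finitely many terms. As
`ζ s - 1 / (s - 1)` is entire, `exp (densitySeries s) = E s / (s - 1)` with `E` entire and without
zeros (`exists_exp_densitySeries`); this produces the simple pole. The partial sums of the centred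
variables are almost surely `O(N ^ r)` for every `r > 1/2`, by Hoeffding's inequality and the
Borel–Cantelli lemma (`IsCenteredBounded.ae_sum_isBigO`), so Abel summation makes `V` converge and
holomorphic on `Re s > 1/2` (`exists_differentiableOn_tendsto_dirichletSeries`). Together these give
the continuation
`exp (V s + V (2 s) / 2 + eulerRemainder s + densitySeries (2 s) / 2) * E s / (s - 1)`.

Near a point `1/2 + i t`, the factors other than `exp (V s)` are bounded below:
`Re (densitySeries (2 s))` tends to `+∞` if `t = 0` and is bounded otherwise, and the rest is
continuous and nonzero (`exists_exp_re_le_norm_continuation`). It remains to see that `Re V` is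
unbounded above along `σ + i t`. Its variance is comparable to
`Re (densitySeries (2 σ)) + Re (densitySeries (2 s))`, which tends to infinity as `σ` decreases to
`1/2`. Comparing second and fourth moments, `Re V` exceeds a fixed fraction of its standard
deviation with probability at least `1/28` (`IsCenteredBounded.le_measure_sum_ge`), and Kolmogorov's
zero–one law turns this into almost sure unboundedness
(`IsCenteredBounded.ae_forall_frequently_lt_sum`). Applying this to all rational `t` at once rules
out an analytic continuation through any point of the critical line.
-/

namespace CramerZeta

/-! ### Dirichlet series with small partial sums -/

lemma norm_natCast_cpow_sub_succ_le {n : ℕ} (hn : n ≠ 0) {s : ℂ} (hs : -1 ≤ s.re) :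
    ‖(n : ℂ) ^ (-s) - ((n + 1 : ℕ) : ℂ) ^ (-s)‖ ≤ ‖s‖ * (n : ℝ) ^ (-s.re - 1) := by
  rcases eq_or_ne s 0 with rfl | hs0
  · simp
  have hn0 : (0 : ℝ) < n := by positivity
  have hd : ∀ x ∈ Set.Icc (n : ℝ) (n + 1), HasDerivWithinAt (fun x : ℝ => (x : ℂ) ^ (-s))
      (-s * (x : ℂ) ^ (-s - 1)) (Set.Icc (n : ℝ) (n + 1)) x := by
    intro x hx
    have hx0 : x ≠ 0 := (hn0.trans_le hx.1).ne'
    exact (hasDerivAt_ofReal_cpow_const hx0 (neg_ne_zero.2 hs0)).hasDerivWithinAt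
  have hb : ∀ x ∈ Set.Icc (n : ℝ) (n + 1),
      ‖-s * (x : ℂ) ^ (-s - 1)‖ ≤ ‖s‖ * (n : ℝ) ^ (-s.re - 1) := by
    intro x hx
    rw [norm_mul, norm_neg, Complex.norm_cpow_eq_rpow_re_of_pos (hn0.trans_le hx.1)]
    gcongr
    simp only [Complex.sub_re, Complex.neg_re, Complex.one_re]
    exact Real.rpow_le_rpow_of_nonpos hn0 hx.1 (by linarith)
  have := (convex_Icc (n : ℝ) (n + 1)).norm_image_sub_le_of_norm_hasDerivWithin_le hd hb
    (x := (n : ℝ) + 1) (y := n) (by simp) (by simp)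
  simpa using this

lemma sum_mul_eq_by_parts (y : ℕ → ℂ) (f : ℕ → ℂ) (N : ℕ) :
    ∑ n ∈ Finset.range N, y n * f n = (∑ n ∈ Finset.range N, y n) * f N +
      ∑ n ∈ Finset.range N, (∑ k ∈ Finset.range (n + 1), y k) * (f n - f (n + 1)) := by
  induction N with
  | zero => simp
  | succ N ih =>
    rw [Finset.sum_range_succ, ih, Finset.sum_range_succ, Finset.sum_range_succ,
      Finset.sum_range_succ]
    ring

/-- If the partial sums of `y` are `O(N ^ r)` for every `r > κ`, the Dirichlet series of `y`
converges (conditionally) to a holomorphic function on `Re s > κ`: by Abel summation it equals an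
absolutely convergent series of the partial sums against the differences of `n ^ (-s)`. -/
theorem exists_differentiableOn_tendsto_dirichletSeries {κ : ℝ} (hκ : 0 ≤ κ) {y : ℕ → ℂ}
    (h0 : y 0 = 0)
    (hS : ∀ r > κ, (fun N => ∑ n ∈ Finset.range N, y n) =O[atTop] fun N : ℕ => (N : ℝ) ^ r) :
    ∃ V : ℂ → ℂ, DifferentiableOn ℂ V {s | κ < s.re} ∧ ∀ s : ℂ, κ < s.re →
      Tendsto (fun N => ∑ n ∈ Finset.range N, y n * (n : ℂ) ^ (-s)) atTop (𝓝 (V s)) := by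
  set S : ℕ → ℂ := fun N => ∑ n ∈ Finset.range N, y n with hSdef
  set F : ℕ → ℂ → ℂ := fun n s => S (n + 1) * ((n : ℂ) ^ (-s) - ((n + 1 : ℕ) : ℂ) ^ (-s)) with hF
  have hS1 : S 1 = 0 := by simp [hSdef, h0]
  -- A summable bound for the terms, uniform on bounded parts of closed half-planes.
  have key : ∀ ρ > κ, ∀ R : ℝ, ∃ u : ℕ → ℝ, Summable u ∧
      ∀ n, ∀ s : ℂ, ρ < s.re → ‖s‖ < R → ‖F n s‖ ≤ u n := by
    intro ρ hρ R
    obtain ⟨r, hr, hrρ⟩ := exists_between hρ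
    have hr0 : 0 < r := hκ.trans_lt hr
    obtain ⟨C, hC, hb⟩ := Asymptotics.bound_of_isBigO_nat_atTop (hS r hr)
    refine ⟨fun n => C * 2 ^ r * R * (n : ℝ) ^ (r - ρ - 1),
      (Real.summable_nat_rpow.2 (by linarith)).mul_left _, fun n s hs hR => ?_⟩
    have hRpos : 0 < R := (norm_nonneg s).trans_lt hR
    rcases eq_or_ne n 0 with rfl | hn
    · simp only [hF, zero_add, hS1, zero_mul, norm_zero]
      positivity
    have hn0 : (0 : ℝ) < n := by positivity
    have hn1 : (1 : ℝ) ≤ n := by exact_mod_cast Nat.one_le_iff_ne_zero.2 hn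
    have h1 : ‖S (n + 1)‖ ≤ C * (2 ^ r * (n : ℝ) ^ r) := by
      refine (hb (x := n + 1) (by positivity)).trans ?_
      rw [Real.norm_of_nonneg (by positivity), ← Real.mul_rpow (by norm_num) hn0.le]
      gcongr
      push_cast
      linarith
    have h2 : ‖(n : ℂ) ^ (-s) - ((n + 1 : ℕ) : ℂ) ^ (-s)‖ ≤ R * (n : ℝ) ^ (-ρ - 1) := by
      refine (norm_natCast_cpow_sub_succ_le hn (by linarith)).trans ?_
      have : (n : ℝ) ^ (-s.re - 1) ≤ (n : ℝ) ^ (-ρ - 1) :=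
        Real.rpow_le_rpow_of_exponent_le hn1 (by linarith)
      gcongr
    calc ‖F n s‖ = ‖S (n + 1)‖ * ‖(n : ℂ) ^ (-s) - ((n + 1 : ℕ) : ℂ) ^ (-s)‖ := norm_mul _ _
      _ ≤ C * (2 ^ r * (n : ℝ) ^ r) * (R * (n : ℝ) ^ (-ρ - 1)) := by gcongr
      _ = C * 2 ^ r * R * (n : ℝ) ^ (r - ρ - 1) := by
        rw [show r - ρ - 1 = r + (-ρ - 1) by ring, Real.rpow_add hn0]
        ring
  refine ⟨fun s => ∑' n, F n s, fun s hs => ?_, fun s hs => ?_⟩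
  · obtain ⟨ρ, hρ, hρs⟩ := exists_between (show κ < s.re from hs)
    obtain ⟨u, hu, hFu⟩ := key ρ hρ (‖s‖ + 1)
    have hU : IsOpen {z : ℂ | ρ < z.re ∧ ‖z‖ < ‖s‖ + 1} :=
      (isOpen_lt continuous_const Complex.continuous_re).inter
        (isOpen_lt continuous_norm continuous_const)
    have hdiff := Complex.differentiableOn_tsum_of_summable_norm hu (F := F)
      (U := {z : ℂ | ρ < z.re ∧ ‖z‖ < ‖s‖ + 1}) (fun n => ?_) hU
      (fun n z hz => hFu n z hz.1 hz.2)
    · exact (hdiff.differentiableAt (hU.mem_nhds ⟨hρs, by simp⟩)).differentiableWithinAt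
    · rcases eq_or_ne n 0 with rfl | hn
      · simp only [hF, zero_add, hS1, zero_mul]
        exact differentiableOn_const _
      · intro z _
        have h1 : (n : ℂ) ≠ 0 := by exact_mod_cast hn
        have h2 : ((n + 1 : ℕ) : ℂ) ≠ 0 := by exact_mod_cast n.succ_ne_zero
        refine DifferentiableAt.differentiableWithinAt ?_
        exact ((differentiableAt_id.neg.const_cpow (Or.inl h1)).sub
          (differentiableAt_id.neg.const_cpow (Or.inl h2))).const_mul _
  · obtain ⟨ρ, hρ, hρs⟩ := exists_between hs
    obtain ⟨u, hu, hFu⟩ := key ρ hρ (‖s‖ + 1)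
    have hsum : Summable fun n => F n s :=
      hu.of_norm_bounded fun n => hFu n s hρs (by simp)
    have h1 := hsum.hasSum.tendsto_sum_nat
    -- The boundary term of the summation by parts vanishes in the limit.
    have h2 : Tendsto (fun N => S N * (N : ℂ) ^ (-s)) atTop (𝓝 0) := by
      have hO : (fun N : ℕ => S N * (N : ℂ) ^ (-s)) =O[atTop]
          fun N : ℕ => (N : ℝ) ^ (-(s.re - ρ)) := by
        have e2 : (fun N : ℕ => (N : ℂ) ^ (-s)) =O[atTop] fun N : ℕ => (N : ℝ) ^ (-s.re) := by
          refine Asymptotics.IsBigO.of_bound 1 ?_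
          filter_upwards [eventually_ge_atTop 1] with N hN
          rw [Complex.norm_natCast_cpow_of_pos hN, Real.norm_of_nonneg (by positivity)]
          simp
        refine ((hS ρ hρ).mul e2).congr' EventuallyEq.rfl ?_
        filter_upwards [eventually_ge_atTop 1] with N hN
        rw [← Real.rpow_add (by exact_mod_cast hN)]
        congr 1
        ring
      exact hO.trans_tendsto
        ((tendsto_rpow_neg_atTop (by linarith)).comp tendsto_natCast_atTop_atTop)
    have h3 := h2.add h1
    rw [zero_add] at h3
    exact h3.congr fun N => (sum_mul_eq_by_parts y (fun n => (n : ℂ) ^ (-s)) N).symm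

/-! ### The logarithm of the Euler product -/

lemma norm_natCast_cpow_neg_le {n : ℕ} (hn : 2 ≤ n) {s : ℂ} {ρ : ℝ} (hρ : 0 ≤ ρ) (hs : ρ ≤ s.re) :
    ‖(n : ℂ) ^ (-s)‖ ≤ (n : ℝ) ^ (-ρ) ∧ ‖(n : ℂ) ^ (-s)‖ ≤ 2 ^ (-ρ) := by
  have h1 : ‖(n : ℂ) ^ (-s)‖ ≤ (n : ℝ) ^ (-ρ) := by
    rw [Complex.norm_natCast_cpow_of_pos (by lia), Complex.neg_re]
    exact Real.rpow_le_rpow_of_exponent_le (by exact_mod_cast (by lia : 1 ≤ n)) (by linarith)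
  exact ⟨h1, h1.trans (Real.rpow_le_rpow_of_nonpos (by norm_num) (by exact_mod_cast hn)
    (by linarith))⟩

lemma two_rpow_neg_lt_one {ρ : ℝ} (hρ : 0 < ρ) : (2 : ℝ) ^ (-ρ) < 1 :=
  Real.rpow_lt_one_of_one_lt_of_neg (by norm_num) (by linarith)

/-- The logarithm of an Euler factor minus the first two terms of its power series in
`n ^ (-s)`. -/
noncomputable def logEulerRemainder (n : ℕ) (s : ℂ) : ℂ :=
  -Complex.log (1 - (n : ℂ) ^ (-s)) - (n : ℂ) ^ (-s) - (n : ℂ) ^ (-(2 * s)) / 2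

lemma natCast_cpow_neg_two_mul (n : ℕ) (s : ℂ) :
    (n : ℂ) ^ (-(2 * s)) = ((n : ℂ) ^ (-s)) ^ 2 := by
  rw [← Complex.cpow_nat_mul]
  congr 1
  push_cast
  ring

lemma norm_logEulerRemainder_le {n : ℕ} (hn : 2 ≤ n) {s : ℂ} {ρ : ℝ} (hρ : 0 < ρ)
    (hs : ρ ≤ s.re) :
    ‖logEulerRemainder n s‖ ≤ (1 - 2 ^ (-ρ))⁻¹ / 3 * (n : ℝ) ^ (-(3 * ρ)) := by
  obtain ⟨h1, h2⟩ := norm_natCast_cpow_neg_le hn hρ.le hs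
  have h3 := two_rpow_neg_lt_one hρ
  set z := (n : ℂ) ^ (-s) with hz
  have hz1 : ‖-z‖ < 1 := by rw [norm_neg]; linarith
  have h4 := Complex.norm_log_sub_logTaylor_le 2 hz1
  have e : logEulerRemainder n s = -(Complex.log (1 + -z) - Complex.logTaylor 3 (-z)) := by
    rw [logEulerRemainder, natCast_cpow_neg_two_mul, ← hz]
    simp [Complex.logTaylor, Finset.sum_range_succ, ← sub_eq_add_neg]
    ring
  rw [e, norm_neg]
  refine h4.trans ?_
  rw [norm_neg]
  have h5 : ‖z‖ ^ 3 ≤ (n : ℝ) ^ (-(3 * ρ)) := by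
    calc ‖z‖ ^ 3 ≤ ((n : ℝ) ^ (-ρ)) ^ 3 := by gcongr
      _ = (n : ℝ) ^ (-(3 * ρ)) := by
        rw [← Real.rpow_natCast, ← Real.rpow_mul (by positivity)]
        congr 1
        push_cast
        ring
  have h6 : (1 - ‖z‖)⁻¹ ≤ (1 - 2 ^ (-ρ))⁻¹ := by
    apply inv_anti₀ <;> linarith
  have h7 : 0 ≤ (1 - ‖z‖)⁻¹ := inv_nonneg.2 (by linarith)
  calc ‖z‖ ^ (2 + 1) * (1 - ‖z‖)⁻¹ / ((2 : ℕ) + 1)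
      ≤ (n : ℝ) ^ (-(3 * ρ)) * (1 - 2 ^ (-ρ))⁻¹ / ((2 : ℕ) + 1) := by gcongr
    _ = _ := by norm_num; ring

lemma one_sub_natCast_cpow_mem_slitPlane {n : ℕ} (hn : 2 ≤ n) {s : ℂ} (hs : 0 < s.re) :
    1 - (n : ℂ) ^ (-s) ∈ Complex.slitPlane := by
  have h := (norm_natCast_cpow_neg_le hn hs.le le_rfl).2.trans_lt (two_rpow_neg_lt_one hs)
  simpa [sub_eq_add_neg] using
    Complex.mem_slitPlane_of_norm_lt_one (z := -(n : ℂ) ^ (-s)) (by rwa [norm_neg])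

/-- The part of the logarithm of the Euler product over `A` coming from third and higher powers. It
converges absolutely on `Re s > 1/3`, a neighbourhood of the critical line. -/
noncomputable def eulerRemainder (A : Set ℕ) (s : ℂ) : ℂ :=
  ∑' n : A, logEulerRemainder n s

lemma summable_logEulerRemainder_bound (A : Set ℕ) {ρ : ℝ} (hρ : 1 / 3 < ρ) :
    Summable fun n : A => (1 - 2 ^ (-ρ))⁻¹ / 3 * ((n : ℕ) : ℝ) ^ (-(3 * ρ)) :=
  ((Real.summable_nat_rpow.2 (by linarith)).mul_left _).subtype A

lemma differentiableOn_eulerRemainder {A : Set ℕ} (hA : ∀ n ∈ A, 2 ≤ n) :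
    DifferentiableOn ℂ (eulerRemainder A) {s | 1 / 3 < s.re} := by
  intro s hs
  obtain ⟨ρ, hρ, hρs⟩ := exists_between (show 1 / 3 < s.re from hs)
  have hU : IsOpen {z : ℂ | ρ < z.re} := isOpen_lt continuous_const Complex.continuous_re
  have hdiff := Complex.differentiableOn_tsum_of_summable_norm
    (summable_logEulerRemainder_bound A hρ)
    (F := fun (n : A) z => logEulerRemainder n z) (fun n z hz => ?_) hU
    (fun n z hz => norm_logEulerRemainder_le (hA n n.2) (by linarith) (le_of_lt hz))
  · exact (hdiff.differentiableAt (hU.mem_nhds hρs)).differentiableWithinAt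
  · have hz0 : 0 < z.re := by
      have : ρ < z.re := hz
      linarith
    have hn : ((n : ℕ) : ℂ) ≠ 0 := by
      have := hA n n.2
      exact_mod_cast (by lia : (n : ℕ) ≠ 0)
    have h1 : DifferentiableAt ℂ (fun z : ℂ => ((n : ℕ) : ℂ) ^ (-z)) z :=
      differentiableAt_id.neg.const_cpow (Or.inl hn)
    have h2 : DifferentiableAt ℂ (fun z : ℂ => ((n : ℕ) : ℂ) ^ (-(2 * z))) z :=
      (differentiableAt_id.const_mul 2).neg.const_cpow (Or.inl hn)
    exact ((((h1.const_sub 1).clog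
      (one_sub_natCast_cpow_mem_slitPlane (hA n n.2) hz0)).neg.sub h1).sub
      (h2.div_const 2)).differentiableWithinAt

lemma summable_natCast_cpow_neg (A : Set ℕ) {s : ℂ} (hs : 1 < s.re) :
    Summable fun n : A => ((n : ℕ) : ℂ) ^ (-s) := by
  have : Summable fun n : ℕ => (n : ℂ) ^ (-s) := by
    simpa [Complex.cpow_neg] using Complex.summable_one_div_nat_cpow.2 hs
  exact this.subtype A

/-- On `Re s > 1` the Euler product over any set of integers `≥ 2` converges, and its logarithm
splits into first, second and higher powers. -/
theorem hasProd_eulerFactor {A : Set ℕ} (hA : ∀ n ∈ A, 2 ≤ n) {s : ℂ} (hs : 1 < s.re) :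
    HasProd (fun p : A => eulerFactor s p) (Complex.exp ((∑' n : A, ((n : ℕ) : ℂ) ^ (-s)) +
      (∑' n : A, ((n : ℕ) : ℂ) ^ (-(2 * s))) / 2 + eulerRemainder A s)) := by
  have h1 := (summable_natCast_cpow_neg A hs).hasSum
  have h2 := (summable_natCast_cpow_neg A (s := 2 * s) (by simp; linarith)).hasSum
  have h3 : Summable fun n : A => logEulerRemainder n s :=
    (summable_logEulerRemainder_bound A (ρ := 1) (by norm_num)).of_norm_bounded fun n =>
      norm_logEulerRemainder_le (hA n n.2) one_pos hs.le
  refine (((h1.add (h2.div_const 2)).add h3.hasSum).cexp).congr fun t => ?_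
  refine Finset.prod_congr rfl fun n _ => ?_
  have h4 := Complex.slitPlane_ne_zero
    (one_sub_natCast_cpow_mem_slitPlane (hA n n.2) (zero_lt_one.trans hs))
  have e : ((n : ℕ) : ℂ) ^ (-s) + ((n : ℕ) : ℂ) ^ (-(2 * s)) / 2 + logEulerRemainder n s =
      -Complex.log (1 - ((n : ℕ) : ℂ) ^ (-s)) := by
    rw [logEulerRemainder]
    ring
  simp only [Function.comp, e, Complex.exp_neg, Complex.exp_log h4, eulerFactor, one_div]
  rw [Complex.cpow_neg]

/-! ### The Dirichlet series of the densities -/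

/-- The probability that `n` is a Cramér quasi-prime, including the deterministic cases `n < 4`. -/
noncomputable def density (n : ℕ) : ℝ := if n < 2 then 0 else if n < 4 then 1 else 1 / Real.log n

lemma four_thirds_le_log {n : ℕ} (hn : 4 ≤ n) : 4 / 3 ≤ Real.log n := by
  have h1 : Real.log 4 ≤ Real.log n := Real.log_le_log (by norm_num) (by exact_mod_cast hn)
  have h2 : Real.log 4 = 2 * Real.log 2 := by
    rw [show (4 : ℝ) = 2 ^ 2 by norm_num, Real.log_pow]
    norm_num
  have := Real.log_two_gt_d9
  linarith

lemma density_of_four_le {n : ℕ} (hn : 4 ≤ n) : density n = 1 / Real.log n := by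
  rw [density, if_neg (by lia), if_neg (by lia)]

lemma density_le_of_four_le {n : ℕ} (hn : 4 ≤ n) : density n ≤ 3 / 4 := by
  rw [density_of_four_le hn]
  have := four_thirds_le_log hn
  rw [div_le_iff₀ (by linarith)]
  linarith

lemma density_nonneg (n : ℕ) : 0 ≤ density n := by
  unfold density
  split_ifs
  · exact le_rfl
  · exact zero_le_one
  · exact one_div_nonneg.2 (Real.log_natCast_nonneg n)

lemma density_le_one (n : ℕ) : density n ≤ 1 := by
  rcases le_or_gt 4 n with hn | hn
  · linarith [density_le_of_four_le hn]
  · rw [density, if_pos hn]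
    split_ifs <;> norm_num

lemma density_zero : density 0 = 0 := by simp [density]

/-- The Dirichlet series of the densities. -/
noncomputable def densitySeries : ℂ → ℂ := LSeries fun n => (density n : ℂ)

lemma densitySeries_hasSum {s : ℂ} (hs : 1 < s.re) :
    HasSum (fun n : ℕ => (density n : ℂ) * (n : ℂ) ^ (-s)) (densitySeries s) := by
  have h : LSeriesSummable (fun n => (density n : ℂ)) s :=
    LSeriesSummable_of_bounded_of_one_lt_re (m := 1) (fun n _ => by
      rw [Complex.norm_of_nonneg (density_nonneg n)]
      exact density_le_one n) hs
  refine HasSum.congr_fun h.LSeriesHasSum fun n => ?_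
  rcases eq_or_ne n 0 with rfl | hn
  · simp [density_zero]
  · rw [LSeries.term_of_ne_zero hn, Complex.cpow_neg, div_eq_mul_inv]

lemma abscissaOfAbsConv_density_lt {s : ℂ} (hs : 1 < s.re) :
    LSeries.abscissaOfAbsConv (fun n => (density n : ℂ)) < s.re :=
  (LSeries.abscissaOfAbsConv_le_of_le_const ⟨1, fun n _ => by
      rw [Complex.norm_of_nonneg (density_nonneg n)]
      exact density_le_one n⟩).trans_lt (by exact_mod_cast hs)

/-- Multiplying by `log n` turns the densities into the constant `1`, up to the terms
`n = 1, 2, 3`. -/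
lemma LSeries_logMul_density {s : ℂ} (hs : 1 < s.re) :
    LSeries (LSeries.logMul fun n => (density n : ℂ)) s = riemannZeta s - 1 +
      (Real.log 2 - 1) * (2 : ℂ) ^ (-s) + (Real.log 3 - 1) * (3 : ℂ) ^ (-s) := by
  set g : ℕ → ℂ := LSeries.term (LSeries.logMul fun n => (density n : ℂ)) s with hg
  have h1 : HasSum (LSeries.term 1 s) (riemannZeta s) := LSeriesHasSum_one hs
  have h2 : HasSum (fun n => g n - LSeries.term 1 s n)
      (∑ n ∈ Finset.range 4, (g n - LSeries.term 1 s n)) := by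
    refine hasSum_sum_of_ne_finset_zero fun n hn => ?_
    have hn4 : 4 ≤ n := by simpa using hn
    have hl := four_thirds_le_log hn4
    have e : Complex.log n * (density n : ℂ) = 1 := by
      rw [density_of_four_le hn4, ← Complex.natCast_log, ← Complex.ofReal_mul, mul_one_div,
        div_self (by linarith), Complex.ofReal_one]
    rw [hg, LSeries.term_of_ne_zero (by lia), LSeries.term_of_ne_zero (by lia), LSeries.logMul, e,
      Pi.one_apply, sub_self]
  have h4 : ∑' n, g n = riemannZeta s + ∑ n ∈ Finset.range 4, (g n - LSeries.term 1 s n) :=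
    ((h1.add h2).congr_fun fun n => by ring).tsum_eq
  have d0 : density 1 = 0 := by norm_num [density]
  have d2 : density 2 = 1 := by norm_num [density]
  have d3 : density 3 = 1 := by norm_num [density]
  rw [LSeries, h4]
  simp only [Finset.sum_range_succ, Finset.sum_range_zero, hg, LSeries.term_zero,
    LSeries.term_of_ne_zero one_ne_zero, LSeries.term_of_ne_zero two_ne_zero,
    LSeries.term_of_ne_zero three_ne_zero, LSeries.logMul, d0, d2, d3, Pi.one_apply,
    Complex.cpow_neg]
  rw [Complex.ofReal_log two_pos.le, Complex.ofReal_log zero_lt_three.le]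
  push_cast
  simp only [Complex.one_cpow]
  ring

lemma sub_one_ne_zero_of_one_lt_re {s : ℂ} (hs : 1 < s.re) : s - 1 ≠ 0 := fun h0 => by
  have : s.re - 1 = 0 := by simpa using congrArg Complex.re h0
  linarith

/-- The density series equals `-log (s - 1)` up to an entire function: its derivative is `-ζ` up to
finitely many terms, and `ζ s - 1 / (s - 1)` is entire, hence has a primitive. -/
theorem exists_exp_densitySeries : ∃ E : ℂ → ℂ, Differentiable ℂ E ∧ (∀ s, E s ≠ 0) ∧
    ∀ s : ℂ, 1 < s.re → Complex.exp (densitySeries s) = E s / (s - 1) := by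
  set h : ℂ → ℂ := fun s => riemannZeta₀ s - 1 +
      (Real.log 2 - 1) * (2 : ℂ) ^ (-s) + (Real.log 3 - 1) * (3 : ℂ) ^ (-s) with hh
  have hd : Differentiable ℂ h := by
    have h2 : Differentiable ℂ fun s : ℂ => (2 : ℂ) ^ (-s) := fun s =>
      differentiableAt_id.neg.const_cpow (Or.inl two_ne_zero)
    have h3 : Differentiable ℂ fun s : ℂ => (3 : ℂ) ^ (-s) := fun s =>
      differentiableAt_id.neg.const_cpow (Or.inl three_ne_zero)
    fun_prop
  obtain ⟨H, hH⟩ := hd.isExactOn_univ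
  replace hH : ∀ s, HasDerivAt H (h s) s := fun s => hH s (Set.mem_univ s)
  set U : Set ℂ := {s | 1 < s.re} with hU
  have hUo : IsOpen U := isOpen_lt continuous_const Complex.continuous_re
  have hUc : Convex ℝ U := convex_halfSpace_re_gt 1
  set f : ℂ → ℂ := fun s => Complex.exp (densitySeries s + H s) * (s - 1) with hf
  have hderiv : ∀ s ∈ U, HasDerivAt f 0 s := by
    intro s hs
    have hs1 : s - 1 ≠ 0 := sub_one_ne_zero_of_one_lt_re hs
    have hD := LSeries_hasDerivAt (abscissaOfAbsConv_density_lt hs)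
    rw [LSeries_logMul_density hs, riemannZeta_eq_inv_sub_add (sub_ne_zero.1 hs1)] at hD
    have := ((hD.add (hH s)).cexp).mul ((hasDerivAt_id s).sub_const 1)
    refine HasDerivAt.congr_deriv (f := f) this ?_
    simp only [hh, id]
    field_simp
    ring
  obtain ⟨c, hc⟩ : ∃ c, ∀ s ∈ U, f s = c := by
    refine ⟨f 2, fun s hs => ?_⟩
    exact hUc.is_const_of_fderivWithin_eq_zero (𝕜 := ℂ)
      (fun z hz => (hderiv z hz).differentiableAt.differentiableWithinAt)
      (fun z hz => by
        rw [fderivWithin_of_isOpen hUo hz]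
        exact (hderiv z hz).hasFDerivAt.fderiv.trans (by ext; simp)) hs (by simp [hU])
  have hc0 : c ≠ 0 := by
    rw [← hc 2 (by simp [hU])]
    simp only [hf]
    norm_num
  refine ⟨fun s => c * Complex.exp (-H s), ?_, fun s => mul_ne_zero hc0 (Complex.exp_ne_zero _),
    fun s hs => ?_⟩
  · have : Differentiable ℂ H := fun s => (hH s).differentiableAt
    fun_prop
  · have hs1 : s - 1 ≠ 0 := sub_one_ne_zero_of_one_lt_re hs
    rw [← hc s hs, eq_div_iff hs1]
    simp only [hf, Complex.exp_add, Complex.exp_neg]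
    field_simp

/-! ### Sums of bounded independent random variables -/

section BoundedSums

variable {Ω : Type*} [MeasurableSpace Ω] {P : Measure Ω}

/-- A sequence of independent centred real random variables with values in `[-1, 1]`. -/
structure IsCenteredBounded (Y : ℕ → Ω → ℝ) (P : Measure Ω) : Prop where
  measurable : ∀ n, Measurable (Y n)
  abs_le_one : ∀ n ω, |Y n ω| ≤ 1
  integral_eq_zero : ∀ n, ∫ ω, Y n ω ∂P = 0
  indep : iIndepFun Y P

namespace IsCenteredBounded

variable {Y : ℕ → Ω → ℝ}

lemma neg (h : IsCenteredBounded Y P) : IsCenteredBounded (fun n ω => -Y n ω) P where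
  measurable n := (h.measurable n).neg
  abs_le_one n ω := by rw [abs_neg]; exact h.abs_le_one n ω
  integral_eq_zero n := by rw [integral_neg, h.integral_eq_zero, neg_zero]
  indep := h.indep.comp (fun _ x => -x) fun _ => measurable_neg

lemma const_mul (h : IsCenteredBounded Y P) {c : ℕ → ℝ} (hc : ∀ n, |c n| ≤ 1) :
    IsCenteredBounded (fun n ω => c n * Y n ω) P where
  measurable n := (h.measurable n).const_mul _
  abs_le_one n ω := by
    rw [abs_mul]
    exact mul_le_one₀ (hc n) (abs_nonneg _) (h.abs_le_one n ω)
  integral_eq_zero n := by rw [integral_const_mul, h.integral_eq_zero, mul_zero]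
  indep := h.indep.comp (fun n x => c n * x) fun n => measurable_const_mul (c n)

lemma abs_sum_le (h : IsCenteredBounded Y P) (N : ℕ) (ω : Ω) :
    |∑ n ∈ Finset.range N, Y n ω| ≤ N := by
  refine (Finset.abs_sum_le_sum_abs _ _).trans ?_
  simpa using Finset.sum_le_sum fun n (_ : n ∈ Finset.range N) => h.abs_le_one n ω

variable [IsProbabilityMeasure P]

/-- **Hoeffding's inequality** for the partial sums. -/
lemma measure_sum_ge_le (h : IsCenteredBounded Y P) (N : ℕ) {ε : ℝ} (hε : 0 ≤ ε) :
    P.real {ω | ε ≤ ∑ n ∈ Finset.range N, Y n ω} ≤ Real.exp (-ε ^ 2 / (2 * N)) := by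
  have := HasSubgaussianMGF.measure_sum_range_ge_le_of_iIndepFun h.indep (c := 1) (n := N)
    (fun n _ => by
      have := hasSubgaussianMGF_of_mem_Icc_of_integral_eq_zero (μ := P) (a := -1) (b := 1)
        (h.measurable n).aemeasurable
        (Eventually.of_forall fun ω => abs_le.1 (h.abs_le_one n ω)) (h.integral_eq_zero n)
      convert this
      rw [← NNReal.coe_inj]
      norm_num) hε
  simpa using this

lemma ae_eventually_sum_lt (h : IsCenteredBounded Y P) :
    ∀ᵐ ω ∂P, ∀ᶠ N : ℕ in atTop,
      ∑ n ∈ Finset.range N, Y n ω < 2 * Real.sqrt (N * Real.log N) := by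
  have hb : ∀ N : ℕ, P {ω | 2 * Real.sqrt (N * Real.log N) ≤ ∑ n ∈ Finset.range N, Y n ω} ≤
      ENNReal.ofReal (1 / (N : ℝ) ^ 2) + if N = 0 then 1 else 0 := by
    intro N
    rcases eq_or_ne N 0 with rfl | hN
    · rw [if_pos rfl]
      exact prob_le_one.trans le_add_self
    rw [if_neg hN, add_zero, ← ofReal_measureReal]
    apply ENNReal.ofReal_le_ofReal
    -- The threshold `2 √(N log N)` is chosen so that Hoeffding's bound is exactly `1 / N ^ 2`.
    refine (h.measure_sum_ge_le N (by positivity)).trans (le_of_eq ?_)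
    have hN0 : (0 : ℝ) < N := by positivity
    rw [mul_pow, Real.sq_sqrt (mul_nonneg hN0.le (Real.log_natCast_nonneg N)), one_div,
      ← Real.exp_log (pow_pos hN0 2), ← Real.exp_neg, Real.log_pow]
    congr 1
    field_simp
    norm_num
    ring
  have hsum : ∑' N : ℕ, P {ω | 2 * Real.sqrt (N * Real.log N) ≤
      ∑ n ∈ Finset.range N, Y n ω} ≠ ⊤ := by
    refine ne_top_of_le_ne_top ?_ (ENNReal.tsum_le_tsum hb)
    rw [ENNReal.tsum_add, tsum_ite_eq]
    exact ENNReal.add_ne_top.2 ⟨(Real.summable_one_div_nat_pow.2 one_lt_two).tsum_ofReal_ne_top,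
      ENNReal.one_ne_top⟩
  filter_upwards [ae_eventually_notMem hsum] with ω hω
  filter_upwards [hω] with N hN
  simpa using hN

lemma sqrt_mul_log_isBigO {r : ℝ} (hr : 1 / 2 < r) :
    (fun N : ℕ => 2 * Real.sqrt (N * Real.log N)) =O[atTop] fun N : ℕ => (N : ℝ) ^ r := by
  have h1 : (fun x : ℝ => Real.sqrt (x * Real.log x)) =O[atTop] fun x : ℝ => x ^ r := by
    have h2 := (isLittleO_log_rpow_atTop (r := 2 * r - 1) (by linarith)).isBigO
    obtain ⟨C, hC⟩ := h2.bound
    refine Asymptotics.IsBigO.of_bound (Real.sqrt C) ?_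
    filter_upwards [hC, eventually_ge_atTop 1] with x hx hx1
    have hx0 : 0 < x := by linarith
    rw [Real.norm_of_nonneg (Real.log_nonneg hx1), Real.norm_of_nonneg (by positivity)] at hx
    rw [Real.norm_of_nonneg (Real.sqrt_nonneg _), Real.norm_of_nonneg (by positivity)]
    have e : x ^ r = Real.sqrt (x ^ (2 * r)) := by
      rw [Real.sqrt_eq_rpow, ← Real.rpow_mul hx0.le]
      congr 1
      ring
    have e2 : x ^ (2 * r) = x * x ^ (2 * r - 1) := by
      rw [Real.rpow_sub_one hx0.ne']
      field_simp
    rw [e, ← Real.sqrt_mul' _ (by positivity), e2]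
    apply Real.sqrt_le_sqrt
    nlinarith
  exact (h1.const_mul_left 2).comp_tendsto tendsto_natCast_atTop_atTop

/-- By Hoeffding's inequality and the Borel–Cantelli lemma, the partial sums almost surely have
square-root size. -/
theorem ae_sum_isBigO (h : IsCenteredBounded Y P) :
    ∀ᵐ ω ∂P, ∀ r : ℝ, 1 / 2 < r →
      (fun N => ∑ n ∈ Finset.range N, Y n ω) =O[atTop] fun N : ℕ => (N : ℝ) ^ r := by
  filter_upwards [h.ae_eventually_sum_lt, h.neg.ae_eventually_sum_lt] with ω h1 h2 r hr
  refine Asymptotics.IsBigO.trans (Asymptotics.IsBigO.of_bound 1 ?_) (sqrt_mul_log_isBigO hr)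
  filter_upwards [h1, h2] with N h1 h2
  rw [Finset.sum_neg_distrib] at h2
  rw [one_mul, Real.norm_eq_abs, Real.norm_of_nonneg (mul_nonneg two_pos.le (Real.sqrt_nonneg _)),
    abs_le]
  constructor <;> linarith

/-- The variance of the `N`-th partial sum. -/
noncomputable def sumVar (Y : ℕ → Ω → ℝ) (P : Measure Ω) (N : ℕ) : ℝ :=
  ∑ n ∈ Finset.range N, ∫ ω, Y n ω ^ 2 ∂P

lemma integrable_sum_pow_mul_pow (h : IsCenteredBounded Y P) (N i j : ℕ) :
    Integrable (fun ω => (∑ n ∈ Finset.range N, Y n ω) ^ i * Y N ω ^ j) P := by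
  refine Integrable.of_bound (C := (N : ℝ) ^ i) ?_ (Eventually.of_forall fun ω => ?_)
  · exact (((Finset.measurable_fun_sum _ fun n _ => h.measurable n).pow_const i).mul
      ((h.measurable N).pow_const j)).aestronglyMeasurable
  · rw [norm_mul, norm_pow, norm_pow, Real.norm_eq_abs, Real.norm_eq_abs]
    calc _ ≤ (N : ℝ) ^ i * 1 := by
          gcongr
          · exact h.abs_sum_le N ω
          · exact pow_le_one₀ (abs_nonneg _) (h.abs_le_one N ω)
      _ = _ := mul_one _

lemma integrable_sum_pow (h : IsCenteredBounded Y P) (N i : ℕ) :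
    Integrable (fun ω => (∑ n ∈ Finset.range N, Y n ω) ^ i) P := by
  simpa using h.integrable_sum_pow_mul_pow N i 0

lemma integrable_pow (h : IsCenteredBounded Y P) (N j : ℕ) :
    Integrable (fun ω => Y N ω ^ j) P := by
  simpa using h.integrable_sum_pow_mul_pow N 0 j

lemma integral_sum_pow_mul_pow (h : IsCenteredBounded Y P) (N i j : ℕ) :
    ∫ ω, (∑ n ∈ Finset.range N, Y n ω) ^ i * Y N ω ^ j ∂P =
      (∫ ω, (∑ n ∈ Finset.range N, Y n ω) ^ i ∂P) * ∫ ω, Y N ω ^ j ∂P := by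
  have h1 : IndepFun (fun ω => ∑ n ∈ Finset.range N, Y n ω) (Y N) P := by
    have := h.indep.indepFun_finsetSum_of_notMem h.measurable (Finset.notMem_range_self (n := N))
    convert this using 1
    ext ω
    simp
  have h2 := h1.comp (measurable_id.pow_const i) (measurable_id.pow_const j)
  exact h2.integral_fun_mul_eq_mul_integral (h.integrable_sum_pow N i).aestronglyMeasurable
    (h.integrable_pow N j).aestronglyMeasurable

lemma integral_sum_eq_zero (h : IsCenteredBounded Y P) (N : ℕ) :
    ∫ ω, ∑ n ∈ Finset.range N, Y n ω ∂P = 0 := by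
  rw [integral_finsetSum _ fun n _ => by simpa using h.integrable_pow n 1]
  simp [h.integral_eq_zero]

lemma integral_sum_sq (h : IsCenteredBounded Y P) (N : ℕ) :
    ∫ ω, (∑ n ∈ Finset.range N, Y n ω) ^ 2 ∂P = sumVar Y P N := by
  induction N with
  | zero => simp [sumVar]
  | succ N ih =>
    have e : ∀ ω, (∑ n ∈ Finset.range (N + 1), Y n ω) ^ 2 = (∑ n ∈ Finset.range N, Y n ω) ^ 2 +
        2 * ((∑ n ∈ Finset.range N, Y n ω) ^ 1 * Y N ω ^ 1) + Y N ω ^ 2 := fun ω => by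
      rw [Finset.sum_range_succ]
      ring
    have i1 := h.integrable_sum_pow N 2
    have i2 := (h.integrable_sum_pow_mul_pow N 1 1).const_mul 2
    have i3 := h.integrable_pow N 2
    simp_rw [e]
    rw [integral_add (i1.fun_add i2) i3, integral_add i1 i2, integral_const_mul,
      h.integral_sum_pow_mul_pow, ih, sumVar, sumVar, Finset.sum_range_succ]
    simp [h.integral_eq_zero]

/-- In the expansion of the fourth moment the odd terms vanish by independence, and
`E Y ^ 4 ≤ E Y ^ 2` because `|Y| ≤ 1`. -/
lemma integral_sum_pow_four_le (h : IsCenteredBounded Y P) (N : ℕ) :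
    ∫ ω, (∑ n ∈ Finset.range N, Y n ω) ^ 4 ∂P ≤ 3 * sumVar Y P N ^ 2 + sumVar Y P N := by
  induction N with
  | zero => simp [sumVar]
  | succ N ih =>
    have e : ∀ ω, (∑ n ∈ Finset.range (N + 1), Y n ω) ^ 4 = (∑ n ∈ Finset.range N, Y n ω) ^ 4 +
        4 * ((∑ n ∈ Finset.range N, Y n ω) ^ 3 * Y N ω ^ 1) +
        6 * ((∑ n ∈ Finset.range N, Y n ω) ^ 2 * Y N ω ^ 2) +
        4 * ((∑ n ∈ Finset.range N, Y n ω) ^ 1 * Y N ω ^ 3) + Y N ω ^ 4 := fun ω => by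
      rw [Finset.sum_range_succ]
      ring
    have i0 := h.integrable_sum_pow N 4
    have i1 := (h.integrable_sum_pow_mul_pow N 3 1).const_mul 4
    have i2 := (h.integrable_sum_pow_mul_pow N 2 2).const_mul 6
    have i3 := (h.integrable_sum_pow_mul_pow N 1 3).const_mul 4
    have i4 := h.integrable_pow N 4
    have h4 : ∫ ω, Y N ω ^ 4 ∂P ≤ ∫ ω, Y N ω ^ 2 ∂P := by
      refine integral_mono i4 (h.integrable_pow N 2) fun ω => ?_
      have := sq_le_one_iff_abs_le_one (Y N ω) |>.2 (h.abs_le_one N ω)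
      nlinarith [sq_nonneg (Y N ω)]
    have h2 : 0 ≤ ∫ ω, Y N ω ^ 2 ∂P := integral_nonneg fun ω => sq_nonneg _
    have hv : sumVar Y P (N + 1) = sumVar Y P N + ∫ ω, Y N ω ^ 2 ∂P := Finset.sum_range_succ _ _
    simp_rw [e]
    rw [integral_add (((i0.fun_add i1).fun_add i2).fun_add i3) i4,
      integral_add ((i0.fun_add i1).fun_add i2) i3, integral_add (i0.fun_add i1) i2, integral_add i0 i1,
      integral_const_mul, integral_const_mul,
      integral_const_mul, h.integral_sum_pow_mul_pow, h.integral_sum_pow_mul_pow,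
      h.integral_sum_pow_mul_pow, h.integral_sum_sq, hv]
    simp only [pow_one, h.integral_sum_eq_zero, h.integral_eq_zero, mul_zero, zero_mul, add_zero]
    nlinarith [sq_nonneg (∫ ω, Y N ω ^ 2 ∂P)]

/-- A partial sum exceeds a fixed fraction of its standard deviation with probability bounded
below: its fourth moment is at most `4` times the square of its variance, and the first moment
vanishes, so that its mass can concentrate neither near `0` nor on the negative half-line. -/
theorem le_measure_sum_ge (h : IsCenteredBounded Y P) {N : ℕ} (hv : 1 ≤ sumVar Y P N) :
    1 / 28 ≤ P.real {ω | Real.sqrt (sumVar Y P N) / 10 ≤ ∑ n ∈ Finset.range N, Y n ω} := by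
  set v := sumVar Y P N with hvdef
  set c := Real.sqrt v with hc
  have hv0 : 0 < v := by linarith
  have hc0 : 0 < c := Real.sqrt_pos.2 hv0
  have hc2 : c ^ 2 = v := Real.sq_sqrt hv0.le
  set W : Ω → ℝ := fun ω => ∑ n ∈ Finset.range N, Y n ω with hW
  set A : Set Ω := {ω | c / 10 ≤ W ω} with hA
  have hAm : MeasurableSet A :=
    measurableSet_le measurable_const (Finset.measurable_fun_sum _ fun n _ => h.measurable n)
  -- The polynomial `2 x + x² - x⁴ / 8 - 1 / 4` is nonpositive for `x < 1 / 10` and at most `7`,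
  -- while its expectation at the normalized sum is at least `1 - 4 / 8 - 1 / 4 = 1 / 4`.
  have hp : ∀ x : ℝ, (x < 1 / 10 → 2 * x + x ^ 2 - x ^ 4 / 8 - 1 / 4 ≤ 0) ∧
      2 * x + x ^ 2 - x ^ 4 / 8 - 1 / 4 ≤ 7 := by
    intro x
    constructor
    · intro hx
      rcases le_or_gt 0 x with h0 | h0
      · nlinarith [pow_nonneg h0 4]
      · rcases le_or_gt (-2) x with h2 | h2
        · nlinarith [pow_nonneg (neg_nonneg.2 h0.le) 4]
        · nlinarith [sq_nonneg (x ^ 2 - 4)]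
    · nlinarith [sq_nonneg (x ^ 2 - 4), sq_nonneg (x - 2)]
  have hle : ∀ ω, 2 / c * W ω + 1 / v * W ω ^ 2 - 1 / (8 * v ^ 2) * W ω ^ 4 - 1 / 4 ≤
      A.indicator (fun _ => 7) ω := by
    intro ω
    have e : 2 / c * W ω + 1 / v * W ω ^ 2 - 1 / (8 * v ^ 2) * W ω ^ 4 - 1 / 4 =
        2 * (W ω / c) + (W ω / c) ^ 2 - (W ω / c) ^ 4 / 8 - 1 / 4 := by
      rw [← hc2]
      field_simp
    rw [e]
    by_cases hω : ω ∈ A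
    · rw [Set.indicator_of_mem hω]
      exact (hp _).2
    · rw [Set.indicator_of_notMem hω]
      refine (hp _).1 ?_
      rw [div_lt_iff₀ hc0]
      have : W ω < c / 10 := not_le.1 hω
      linarith
  have i1 : Integrable (fun ω => 2 / c * W ω) P :=
    (by simpa using h.integrable_sum_pow N 1 : Integrable W P).const_mul _
  have i2 : Integrable (fun ω => 1 / v * W ω ^ 2) P := (h.integrable_sum_pow N 2).const_mul _
  have i4 : Integrable (fun ω => 1 / (8 * v ^ 2) * W ω ^ 4) P :=
    (h.integrable_sum_pow N 4).const_mul _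
  have i3 : Integrable (fun ω => 2 / c * W ω + 1 / v * W ω ^ 2 - 1 / (8 * v ^ 2) * W ω ^ 4) P :=
    (i1.add i2).sub i4
  have i5 : Integrable (fun ω => 2 / c * W ω + 1 / v * W ω ^ 2 - 1 / (8 * v ^ 2) * W ω ^ 4 -
      1 / 4) P := i3.sub (integrable_const _)
  have hint := integral_mono i5
    ((integrable_const (7 : ℝ)).indicator hAm) hle
  rw [integral_sub i3 (integrable_const _), integral_sub (i1.fun_add i2) i4,
    integral_add i1 i2, integral_const_mul, integral_const_mul, integral_const_mul,
    h.integral_sum_eq_zero, h.integral_sum_sq, integral_indicator_const _ hAm, ← hvdef] at hint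
  have h4 : 1 / (8 * v ^ 2) * ∫ ω, W ω ^ 4 ∂P ≤ 1 / 2 := by
    have := h.integral_sum_pow_four_le N
    rw [← hvdef] at this
    rw [one_div, inv_mul_le_iff₀ (by positivity)]
    nlinarith
  rw [one_div_mul_cancel hv0.ne'] at hint
  simp only [integral_const, probReal_univ, smul_eq_mul] at hint
  linarith

end IsCenteredBounded

end BoundedSums

/-! ### Almost sure unboundedness of weighted sums -/

lemma measurableSet_forall_frequently_lt {Ω : Type*} [MeasurableSpace Ω] {f : ℕ → ℕ → Ω → ℝ}
    (hf : ∀ k N, Measurable (f k N)) :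
    MeasurableSet {ω | ∀ M : ℕ, ∃ᶠ k in atTop, ∃ᶠ N in atTop, (M : ℝ) < f k N ω} := by
  simp only [frequently_atTop, Set.ofPred_forall, Set.ofPred_exists, Set.ofPred_and]
  exact .iInter fun M => .iInter fun a => .iUnion fun k => (MeasurableSet.const _).inter <|
    .iInter fun b => .iUnion fun N => (MeasurableSet.const _).inter <|
      measurableSet_lt measurable_const (hf k N)

lemma setOf_frequently_mem_eq {Ω : Type*} (A : ℕ → Set Ω) :
    {ω | ∃ᶠ k in atTop, ω ∈ A k} = ⋂ a, ⋃ k, ⋃ _ : a ≤ k, A k := by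
  ext ω
  simp [frequently_atTop]

section Unboundedness

variable {Ω : Type*} [MeasurableSpace Ω] {P : Measure Ω} [IsProbabilityMeasure P]

lemma le_measure_iInter_of_antitone {B : ℕ → Set Ω} (hB : ∀ a, MeasurableSet (B a))
    (hanti : Antitone B) {c : ENNReal} (h : ∀ a, c ≤ P (B a)) : c ≤ P (⋂ a, B a) :=
  ge_of_tendsto' (tendsto_measure_iInter_atTop (fun a => (hB a).nullMeasurableSet) hanti
    ⟨0, measure_ne_top P _⟩) h

lemma measurableSet_frequently_mem {A : ℕ → Set Ω} (hA : ∀ k, MeasurableSet (A k)) :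
    MeasurableSet {ω | ∃ᶠ k in atTop, ω ∈ A k} := by
  rw [setOf_frequently_mem_eq]
  exact .iInter fun a => .iUnion fun k => .iUnion fun _ => hA k

lemma le_measure_frequently_mem {A : ℕ → Set Ω} (hA : ∀ k, MeasurableSet (A k)) {c : ENNReal}
    (h : ∀ᶠ k in atTop, c ≤ P (A k)) : c ≤ P {ω | ∃ᶠ k in atTop, ω ∈ A k} := by
  rw [setOf_frequently_mem_eq]
  have hanti : Antitone fun a => ⋃ k, ⋃ _ : a ≤ k, A k := fun a b hab =>
    Set.iUnion_mono fun k => Set.iUnion_mono' fun hk => ⟨hab.trans hk, le_rfl⟩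
  refine le_measure_iInter_of_antitone (fun a => .iUnion fun k => .iUnion fun _ => hA k) hanti
    fun a => ?_
  obtain ⟨k, hk, hak⟩ := (h.and (eventually_ge_atTop a)).exists
  exact hk.trans (measure_mono (Set.subset_iUnion₂_of_subset k hak le_rfl))

lemma forall_frequently_lt_of_le_add {x y : ℕ → ℕ → ℝ} {C : ℝ}
    (hxy : ∀ k, ∀ᶠ N in atTop, x k N ≤ y k N + C)
    (hx : ∀ M : ℕ, ∃ᶠ k in atTop, ∃ᶠ N in atTop, (M : ℝ) < x k N) :
    ∀ M : ℕ, ∃ᶠ k in atTop, ∃ᶠ N in atTop, (M : ℝ) < y k N := by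
  intro M
  obtain ⟨M', hM'⟩ := exists_nat_ge (M + C)
  refine (hx M').mono fun k hk => (hk.and_eventually (hxy k)).mono fun N hN => ?_
  linarith [hN.1, hN.2]

/-- If the variances of weighted sums of independent centred bounded variables tend to infinity,
then almost surely these sums are unbounded above. Moment bounds give this with positive
probability, and Kolmogorov's zero–one law upgrades it, since changing finitely many of the
variables changes all the sums by a bounded amount. -/
theorem IsCenteredBounded.ae_forall_frequently_lt_sum {Y : ℕ → Ω → ℝ}
    (h : IsCenteredBounded Y P) {c : ℕ → ℕ → ℝ} (hc : ∀ k n, |c k n| ≤ 1)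
    (hvar : ∀ M : ℝ, ∀ᶠ k in atTop, ∀ᶠ N in atTop,
      M ≤ IsCenteredBounded.sumVar (fun n ω => c k n * Y n ω) P N) :
    ∀ᵐ ω ∂P, ∀ M : ℕ, ∃ᶠ k in atTop, ∃ᶠ N in atTop,
      (M : ℝ) < ∑ n ∈ Finset.range N, c k n * Y n ω := by
  set f : ℕ → ℕ → Ω → ℝ := fun k N ω => ∑ n ∈ Finset.range N, c k n * Y n ω with hf
  set T : Set Ω := {ω | ∀ M : ℕ, ∃ᶠ k in atTop, ∃ᶠ N in atTop, (M : ℝ) < f k N ω} with hT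
  have hfm : ∀ k N, Measurable (f k N) := fun k N =>
    Finset.measurable_fun_sum _ fun n _ => (h.measurable n).const_mul _
  have hTm : MeasurableSet T := measurableSet_forall_frequently_lt hfm
  have hpos : ENNReal.ofReal (1 / 28) ≤ P T := by
    have e : T = ⋂ M : ℕ, {ω | ∃ᶠ k in atTop, ω ∈ {ω | ∃ᶠ N in atTop,
        ω ∈ {ω | (M : ℝ) < f k N ω}}} := by
      ext ω
      simp [hT]
    have hm1 : ∀ (M k N : ℕ), MeasurableSet {ω | (M : ℝ) < f k N ω} := fun M k N =>
      measurableSet_lt measurable_const (hfm k N)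
    have hm2 := fun M k => measurableSet_frequently_mem (hm1 M k)
    rw [e]
    refine le_measure_iInter_of_antitone (fun M => measurableSet_frequently_mem (hm2 M))
      (fun M M' hM ω hω => ?_) fun M => ?_
    · refine Frequently.mono hω fun k hk => Frequently.mono hk fun N hN => ?_
      exact lt_of_le_of_lt (Nat.cast_le.2 hM) (show (M' : ℝ) < f k N ω from hN)
    · refine le_measure_frequently_mem (hm2 M) ?_
      filter_upwards [hvar ((10 * (M + 1)) ^ 2)] with k hk
      refine le_measure_frequently_mem (hm1 M k) ?_
      filter_upwards [hk] with N hN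
      have hM0 : (0 : ℝ) ≤ M := Nat.cast_nonneg M
      have h1 := (h.const_mul (hc k)).le_measure_sum_ge (N := N) (by nlinarith)
      refine (ENNReal.ofReal_le_ofReal h1).trans ?_
      rw [ofReal_measureReal]
      refine measure_mono fun ω hω => ?_
      have h2 : 10 * ((M : ℝ) + 1) ≤
          Real.sqrt (IsCenteredBounded.sumVar (fun n ω => c k n * Y n ω) P N) :=
        Real.le_sqrt_of_sq_le hN
      have h3 : _ ≤ f k N ω := hω
      simp only [Set.mem_ofPred_eq]
      linarith
  -- The event depends only on the variables with index at least `m`, for every `m`.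
  have htail : MeasurableSet[limsup (fun n => MeasurableSpace.comap (Y n) inferInstance) atTop]
      T := by
    rw [limsup_eq_iInf_iSup_of_nat, MeasurableSpace.measurableSet_iInf]
    intro m
    have e : T = {ω | ∀ M : ℕ, ∃ᶠ k in atTop, ∃ᶠ N in atTop,
        (M : ℝ) < ∑ n ∈ Finset.Ico m N, c k n * Y n ω} := by
      have hbd : ∀ k ω, ∀ᶠ N in atTop,
          |f k N ω - ∑ n ∈ Finset.Ico m N, c k n * Y n ω| ≤ m := by
        intro k ω
        filter_upwards [eventually_ge_atTop m] with N hN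
        simp only [hf]
        rw [← Finset.sum_range_add_sum_Ico _ hN, add_sub_cancel_right]
        exact (h.const_mul (hc k)).abs_sum_le m ω
      ext ω
      constructor
      · refine forall_frequently_lt_of_le_add (C := m) fun k => ?_
        filter_upwards [hbd k ω] with N hN
        linarith [(abs_le.1 hN).2]
      · refine forall_frequently_lt_of_le_add (C := m) fun k => ?_
        filter_upwards [hbd k ω] with N hN
        linarith [(abs_le.1 hN).1]
    rw [e]
    refine @measurableSet_forall_frequently_lt Ω
      (⨆ i, ⨆ _ : i ≥ m, MeasurableSpace.comap (Y i) inferInstance)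
      (fun k N ω => ∑ n ∈ Finset.Ico m N, c k n * Y n ω) fun k N => ?_
    refine Finset.measurable_fun_sum _ fun n hn => Measurable.const_mul ?_ _
    exact Measurable.mono (comap_measurable (Y n))
      (le_iSup₂_of_le n (Finset.mem_Ico.1 hn).1 le_rfl) le_rfl
  rcases measure_zero_or_one_of_measurableSet_limsup_atTop (fun n => (h.measurable n).comap_le)
    h.indep htail with h0 | h1
  · rw [h0] at hpos
    norm_num at hpos
  · exact (mem_ae_iff_prob_eq_one hTm).2 h1

end Unboundedness

/-! ### Boundary behaviour of the density series -/

lemma differentiableOn_densitySeries : DifferentiableOn ℂ densitySeries {s | 1 < s.re} :=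
  fun _ hs => (LSeries_hasDerivAt
    (abscissaOfAbsConv_density_lt hs)).differentiableAt.differentiableWithinAt

lemma exp_re_densitySeries {E : ℂ → ℂ}
    (hE : ∀ s : ℂ, 1 < s.re → Complex.exp (densitySeries s) = E s / (s - 1)) {s : ℂ}
    (hs : 1 < s.re) : Real.exp (densitySeries s).re = ‖E s‖ / ‖s - 1‖ := by
  rw [← Complex.norm_exp, hE s hs, norm_div]

/-- Near the line `Re s = 1` the real part of the density series can only become large, not very
negative: it is `log ‖E s‖ - log ‖s - 1‖`, and `E` has no zeros. -/
lemma densitySeries_re_bddBelow (w : ℂ) :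
    ∃ C : ℝ, ∀ᶠ s in 𝓝[{s : ℂ | 1 < s.re}] w, C ≤ (densitySeries s).re := by
  obtain ⟨E, hEd, hE0, hE⟩ := exists_exp_densitySeries
  have hw := norm_pos_iff.2 (hE0 w)
  refine ⟨Real.log (‖E w‖ / 2 / (‖w - 1‖ + 1)), ?_⟩
  have h1 : ∀ᶠ s in 𝓝 w, ‖E w‖ / 2 < ‖E s‖ :=
    hEd.continuous.norm.continuousAt.eventually_const_lt (by linarith)
  have h2 : ∀ᶠ s in 𝓝 w, ‖s - 1‖ < ‖w - 1‖ + 1 :=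
    (continuous_id.sub continuous_const).norm.continuousAt.eventually_lt_const (by simp)
  filter_upwards [mem_nhdsWithin_of_mem_nhds h1, mem_nhdsWithin_of_mem_nhds h2,
    self_mem_nhdsWithin] with s h1 h2 hs
  have hs1 : 0 < ‖s - 1‖ := norm_pos_iff.2 (sub_one_ne_zero_of_one_lt_re hs)
  rw [Real.log_le_iff_le_exp (by positivity), exp_re_densitySeries hE hs]
  have : 0 ≤ ‖E w‖ / 2 := by positivity
  gcongr

lemma tendsto_densitySeries_re_one :
    Tendsto (fun s => (densitySeries s).re) (𝓝[{s : ℂ | 1 < s.re}] 1) atTop := by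
  obtain ⟨E, hEd, hE0, hE⟩ := exists_exp_densitySeries
  have h1 : Tendsto (fun s => ‖E s‖) (𝓝[{s : ℂ | 1 < s.re}] 1) (𝓝 ‖E 1‖) :=
    hEd.continuous.norm.continuousAt.tendsto.mono_left nhdsWithin_le_nhds
  have h2 : Tendsto (fun s : ℂ => ‖s - 1‖) (𝓝[{s : ℂ | 1 < s.re}] 1) (𝓝[>] 0) := by
    refine tendsto_nhdsWithin_iff.2 ⟨?_, ?_⟩
    · have : Tendsto (fun s : ℂ => ‖s - 1‖) (𝓝 1) (𝓝 ‖(1 : ℂ) - 1‖) :=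
        (continuous_id.sub continuous_const).norm.continuousAt.tendsto
      simp only [sub_self, norm_zero] at this
      exact this.mono_left nhdsWithin_le_nhds
    · filter_upwards [self_mem_nhdsWithin] with s hs
      exact norm_pos_iff.2 (sub_one_ne_zero_of_one_lt_re hs)
  have h3 := (Real.tendsto_log_atTop.comp
    (h1.pos_mul_atTop (norm_pos_iff.2 (hE0 1)) h2.inv_tendsto_nhdsGT_zero))
  refine h3.congr' ?_
  filter_upwards [self_mem_nhdsWithin] with s hs
  have := exp_re_densitySeries hE hs
  simp only [Function.comp, Pi.inv_apply]
  rw [← div_eq_mul_inv, ← this, Real.log_exp]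

lemma re_add_ofReal_mul_I (σ t : ℝ) : ((σ : ℂ) + (t : ℂ) * Complex.I).re = σ := by simp

lemma tendsto_two_mul_add_mul_I (t : ℝ) :
    Tendsto (fun σ : ℝ => 2 * ((σ : ℂ) + (t : ℂ) * Complex.I)) (𝓝[>] (1 / 2))
      (𝓝[{s : ℂ | 1 < s.re}] (1 + 2 * (t : ℂ) * Complex.I)) := by
  refine tendsto_nhdsWithin_iff.2 ⟨?_, ?_⟩
  · have : ContinuousAt (fun σ : ℝ => 2 * ((σ : ℂ) + (t : ℂ) * Complex.I)) (1 / 2) := by fun_prop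
    have h := this.tendsto.mono_left (nhdsWithin_le_nhds (s := Set.Ioi (1 / 2 : ℝ)))
    convert h using 2
    push_cast
    ring
  · filter_upwards [self_mem_nhdsWithin] with σ hσ
    have : (1 / 2 : ℝ) < σ := hσ
    simp
    linarith

lemma re_sq_eq (z : ℂ) : z.re ^ 2 = (‖z‖ ^ 2 + (z ^ 2).re) / 2 := by
  rw [Complex.sq_norm, Complex.normSq_apply, sq z, Complex.mul_re]
  ring

lemma abs_re_natCast_cpow_neg_le_one (n : ℕ) {s : ℂ} (hs : 0 < s.re) :
    |((n : ℂ) ^ (-s)).re| ≤ 1 := by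
  refine (Complex.abs_re_le_norm _).trans ?_
  rcases eq_or_ne n 0 with rfl | hn
  · have : s ≠ 0 := by
      rintro rfl
      simp at hs
    simp [this]
  · rw [Complex.norm_natCast_cpow_of_pos (Nat.pos_of_ne_zero hn), Complex.neg_re]
    exact Real.rpow_le_one_of_one_le_of_nonpos
      (by exact_mod_cast Nat.one_le_iff_ne_zero.2 hn) (by linarith)

/-- The identity `(Re z)² = (‖z‖² + Re z²) / 2` expresses the limiting variance at `s` through the
density series at `2 Re s` and `2 s`. -/
lemma hasSum_density_mul_re_sq {s : ℂ} (hs : 1 / 2 < s.re) :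
    HasSum (fun n : ℕ => density n * ((n : ℂ) ^ (-s)).re ^ 2)
      (((densitySeries (2 * (s.re : ℂ))).re + (densitySeries (2 * s)).re) / 2) := by
  have h1 := Complex.hasSum_re (densitySeries_hasSum (s := 2 * (s.re : ℂ)) (by simp; linarith))
  have h2 := Complex.hasSum_re (densitySeries_hasSum (s := 2 * s) (by simp; linarith))
  refine ((h1.add h2).div_const 2).congr_fun fun n => ?_
  rcases eq_or_ne n 0 with rfl | hn
  · simp [density_zero]
  have e : ((n : ℂ) ^ (-(2 * (s.re : ℂ)))).re = ‖(n : ℂ) ^ (-s)‖ ^ 2 := by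
    rw [natCast_cpow_neg_two_mul, Complex.norm_natCast_cpow_of_pos (Nat.pos_of_ne_zero hn),
      Complex.neg_re, ← Complex.ofReal_neg, ← Complex.ofReal_natCast,
      ← Complex.ofReal_cpow (Nat.cast_nonneg n), ← Complex.ofReal_pow, Complex.ofReal_re]
  rw [Complex.re_ofReal_mul, Complex.re_ofReal_mul, e, natCast_cpow_neg_two_mul, re_sq_eq]
  ring

/-- The first summand tends to infinity because of the singularity of the density series at `1`, and
the second is bounded below, whether `t = 0` or not. -/
lemma tendsto_densitySeries_re_add (t : ℝ) :
    Tendsto (fun σ : ℝ => ((densitySeries (2 * (σ : ℂ))).re +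
      (densitySeries (2 * ((σ : ℂ) + (t : ℂ) * Complex.I))).re) / 2) (𝓝[>] (1 / 2)) atTop := by
  obtain ⟨C, hC⟩ := densitySeries_re_bddBelow (1 + 2 * (t : ℂ) * Complex.I)
  have h1 : Tendsto (fun σ : ℝ => (densitySeries (2 * (σ : ℂ))).re) (𝓝[>] (1 / 2)) atTop := by
    have := tendsto_two_mul_add_mul_I 0
    simp only [Complex.ofReal_zero, zero_mul, add_zero, mul_zero] at this
    exact tendsto_densitySeries_re_one.comp this
  exact (tendsto_atTop_add_right_of_le' _ C h1
    ((tendsto_two_mul_add_mul_I t).eventually hC)).atTop_div_const two_pos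

/-! ### The indicator process of the quasi-primes -/

/-- The indicator of `n ∈ A` minus the probability that `n` is a Cramér quasi-prime. -/
noncomputable def centered (A : Set ℕ) (n : ℕ) : ℝ := A.indicator 1 n - density n

lemma centered_eq_indicator {Ω : Type*} (Q : Ω → Set ℕ) (n : ℕ) (ω : Ω) : centered (Q ω) n =
    {ω | n ∈ Q ω}.indicator (fun _ => (1 : ℝ)) ω - density n := by
  classical
  simp [centered, Set.indicator_apply]

section Indicators

variable {Ω : Type*} [MeasurableSpace Ω] {P : Measure Ω} {Q : Ω → Set ℕ}

lemma setOf_mem_eq_empty (hQ : IsCramerQuasiPrimes P Q) {n : ℕ} (hn : n < 2) :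
    {ω | n ∈ Q ω} = ∅ := by
  ext ω
  simpa using fun h => (hQ.two_le ω n h).not_gt hn

lemma setOf_mem_eq_univ (hQ : IsCramerQuasiPrimes P Q) {n : ℕ} (hn : 2 ≤ n) (hn4 : n < 4) :
    {ω | n ∈ Q ω} = Set.univ := by
  ext ω
  obtain rfl | rfl : n = 2 ∨ n = 3 := by lia
  · simp [hQ.two_mem]
  · simp [hQ.three_mem]

variable [IsProbabilityMeasure P]

lemma measure_mem_eq (hQ : IsCramerQuasiPrimes P Q) (n : ℕ) :
    P {ω | n ∈ Q ω} = ENNReal.ofReal (density n) := by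
  rcases lt_or_ge n 2 with h2 | h2
  · simp [setOf_mem_eq_empty hQ h2, density, h2]
  rcases lt_or_ge n 4 with h4 | h4
  · simp [setOf_mem_eq_univ hQ h2 h4, density, h2.not_gt, h4]
  · rw [hQ.prob_mem n h4, density_of_four_le h4]

/-- Adding the deterministic events for `n < 4` keeps the family independent. -/
lemma iIndepSet_mem (hQ : IsCramerQuasiPrimes P Q) :
    iIndepSet (fun n : ℕ => {ω | n ∈ Q ω}) P := by
  rw [iIndepSet_iff_meas_biInter hQ.measurableSet_mem]
  intro s
  by_cases hs : ∃ n ∈ s, n < 2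
  · obtain ⟨n, hns, hn⟩ := hs
    rw [Finset.prod_eq_zero hns (by rw [setOf_mem_eq_empty hQ hn, measure_empty])]
    refine measure_mono_null (Set.biInter_subset_of_mem hns) ?_
    rw [setOf_mem_eq_empty hQ hn, measure_empty]
  push Not at hs
  have h := hQ.indep.meas_biInter (s.subtype (4 ≤ ·))
  have e1 : ⋂ i ∈ s, {ω | i ∈ Q ω} =
      ⋂ i ∈ s.subtype (4 ≤ ·), {ω | ((i : {n : ℕ // 4 ≤ n}) : ℕ) ∈ Q ω} := by
    ext ω
    simp only [Set.mem_iInter, Finset.mem_subtype, Set.mem_ofPred_eq, Subtype.forall]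
    refine ⟨fun h i _ hi => h i hi, fun h i hi => ?_⟩
    rcases lt_or_ge i 4 with h4 | h4
    · have : ω ∈ {ω | i ∈ Q ω} := by
        rw [setOf_mem_eq_univ hQ (hs i hi) h4]
        trivial
      exact this
    · exact h i h4 hi
  rw [e1, h, Finset.prod_subtype_eq_prod_filter (f := fun i => P {ω | i ∈ Q ω})]
  refine Finset.prod_filter_of_ne fun i hi hne => ?_
  by_contra h4
  exact hne (by rw [setOf_mem_eq_univ hQ (hs i hi) (not_le.1 h4), measure_univ])

lemma integral_indicator_mem (hQ : IsCramerQuasiPrimes P Q) (n : ℕ) :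
    ∫ ω, {ω | n ∈ Q ω}.indicator (fun _ => (1 : ℝ)) ω ∂P = density n := by
  rw [integral_indicator_const _ (hQ.measurableSet_mem n), smul_eq_mul, mul_one, measureReal_def,
    measure_mem_eq hQ, ENNReal.toReal_ofReal (density_nonneg n)]

lemma integrable_indicator_mem (hQ : IsCramerQuasiPrimes P Q) (n : ℕ) :
    Integrable (fun ω => {ω | n ∈ Q ω}.indicator (fun _ => (1 : ℝ)) ω) P :=
  (integrable_const 1).indicator (hQ.measurableSet_mem n)

lemma isCenteredBounded_centered (hQ : IsCramerQuasiPrimes P Q) :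
    IsCenteredBounded (fun n ω => centered (Q ω) n) P where
  measurable n := by
    simp_rw [centered_eq_indicator]
    exact (measurable_const.indicator (hQ.measurableSet_mem n)).sub_const _
  abs_le_one n ω := by
    have h0 := density_nonneg n
    have h1 := density_le_one n
    classical
    rw [centered, Set.indicator_apply]
    split_ifs <;> rw [abs_le] <;> constructor <;> simp <;> linarith
  integral_eq_zero n := by
    simp_rw [centered_eq_indicator]
    rw [integral_sub (integrable_indicator_mem hQ n) (integrable_const _),
      integral_indicator_mem hQ]
    simp
  indep := by
    have := (iIndepSet_mem hQ).iIndepFun_indicator (β := ℝ) (m := Real.measurableSpace)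
    have h2 := this.comp (fun n x => x - density n) fun n => measurable_id.sub_const _
    have e : (fun (n : ℕ) ω => centered (Q ω) n) = fun n =>
        (fun x : ℝ => x - density n) ∘ {ω | n ∈ Q ω}.indicator fun _ => (1 : ℝ) := by
      funext n ω
      exact centered_eq_indicator Q n ω
    rw [e]
    exact h2

lemma integral_centered_sq (hQ : IsCramerQuasiPrimes P Q) (n : ℕ) :
    ∫ ω, centered (Q ω) n ^ 2 ∂P = density n * (1 - density n) := by
  have e : ∀ ω, centered (Q ω) n ^ 2 = (1 - 2 * density n) *
      {ω | n ∈ Q ω}.indicator (fun _ => (1 : ℝ)) ω + density n ^ 2 := by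
    intro ω
    classical
    rw [centered_eq_indicator, Set.indicator_apply]
    split_ifs <;> ring
  simp_rw [e]
  rw [integral_add ((integrable_indicator_mem hQ n).const_mul _) (integrable_const _),
    integral_const_mul, integral_indicator_mem hQ]
  simp
  ring

/-- The variance `density n * (1 - density n)` is at least a quarter of `density n` for `n ≥ 4`; the
terms with `n < 4`, of which two have density `1` and variance `0`, cost at most `1`. -/
lemma le_sumVar_centered (hQ : IsCramerQuasiPrimes P Q) {c : ℕ → ℝ} (hc : ∀ n, |c n| ≤ 1) (N : ℕ) :
    (∑ n ∈ Finset.range N, density n * c n ^ 2) / 4 - 1 ≤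
      IsCenteredBounded.sumVar (fun n ω => c n * centered (Q ω) n) P N := by
  have h1 : ∀ n, density n * c n ^ 2 / 4 - (if n < 4 then 1 / 4 else 0) ≤
      ∫ ω, (c n * centered (Q ω) n) ^ 2 ∂P := by
    intro n
    simp_rw [mul_pow]
    rw [integral_const_mul, integral_centered_sq hQ]
    have hd0 := density_nonneg n
    have hd1 := density_le_one n
    have hc1 : c n ^ 2 ≤ 1 := (sq_le_one_iff_abs_le_one _).2 (hc n)
    have hc0 := sq_nonneg (c n)
    split_ifs with h4
    · have : 0 ≤ c n ^ 2 * (density n * (1 - density n)) :=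
        mul_nonneg hc0 (mul_nonneg hd0 (by linarith))
      nlinarith
    · have := density_le_of_four_le (not_lt.1 h4)
      have := mul_nonneg (mul_nonneg hc0 hd0) (show 0 ≤ 3 / 4 - density n by linarith)
      nlinarith
  have h2 := Finset.sum_le_sum fun n (_ : n ∈ Finset.range N) => h1 n
  rw [Finset.sum_sub_distrib, ← Finset.sum_div] at h2
  have h3 : ∑ n ∈ Finset.range N, (if n < 4 then (1 / 4 : ℝ) else 0) ≤ 1 := by
    rw [← Finset.sum_filter]
    calc _ ≤ ∑ n ∈ Finset.range 4, (1 / 4 : ℝ) :=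
          Finset.sum_le_sum_of_subset_of_nonneg (fun n hn => by simp at hn ⊢; exact hn.2)
            fun _ _ _ => by norm_num
      _ = 1 := by norm_num
  exact (by linarith : _ ≤ _).trans h2

/-- For fixed `t`, the real parts of the random Dirichlet polynomials at `σ + i t` are almost surely
unbounded above as `σ` decreases to `1/2` along a sequence. -/
theorem ae_frequently_lt_sum_centered (hQ : IsCramerQuasiPrimes P Q) (t : ℝ) {σ : ℕ → ℝ}
    (hσ : ∀ k, 1 / 2 < σ k) (hσt : Tendsto σ atTop (𝓝[>] (1 / 2))) :
    ∀ᵐ ω ∂P, ∀ M : ℕ, ∃ᶠ k in atTop, ∃ᶠ N in atTop, (M : ℝ) < ∑ n ∈ Finset.range N,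
      ((n : ℂ) ^ (-((σ k : ℂ) + (t : ℂ) * Complex.I))).re * centered (Q ω) n := by
  have hc : ∀ (k n : ℕ), |((n : ℂ) ^ (-((σ k : ℂ) + (t : ℂ) * Complex.I))).re| ≤ 1 := fun k n =>
    abs_re_natCast_cpow_neg_le_one n (by
      rw [re_add_ofReal_mul_I]
      linarith [hσ k])
  refine (isCenteredBounded_centered hQ).ae_forall_frequently_lt_sum hc fun M => ?_
  filter_upwards [((tendsto_densitySeries_re_add t).comp hσt).eventually_gt_atTop
    (4 * (M + 1))] with k hk
  have hs := (hasSum_density_mul_re_sq (s := (σ k : ℂ) + (t : ℂ) * Complex.I) (by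
    rw [re_add_ofReal_mul_I]
    exact hσ k)).tendsto_sum_nat
  rw [re_add_ofReal_mul_I] at hs
  filter_upwards [hs.eventually_const_lt hk] with N hN
  linarith [le_sumVar_centered hQ (hc k) N]

end Indicators

/-! ### The continued zeta function -/

/-- The continuation of the Euler product over `A`, where `V` continues the Dirichlet series of the
centred indicators of `A`, and `E s / (s - 1)` continues `exp (densitySeries s)`. -/
noncomputable def continuation (E V : ℂ → ℂ) (A : Set ℕ) (s : ℂ) : ℂ :=
  Complex.exp (V s + (V (2 * s) / 2 + eulerRemainder A s) + densitySeries (2 * s) / 2) *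
    (E s / (s - 1))

/-- `V` is the sum of the Dirichlet series of the centred indicators of `A` on `Re s > 1/2`. -/
structure IsCenteredSeries (A : Set ℕ) (V : ℂ → ℂ) : Prop where
  differentiableOn : DifferentiableOn ℂ V {s | 1 / 2 < s.re}
  tendsto : ∀ s : ℂ, 1 / 2 < s.re → Tendsto
    (fun N => ∑ n ∈ Finset.range N, (centered A n : ℂ) * (n : ℂ) ^ (-s)) atTop (𝓝 (V s))

section Deterministic

variable {A : Set ℕ} {E V : ℂ → ℂ}

lemma exists_isCenteredSeries (hA : ∀ n ∈ A, 2 ≤ n) (hS : ∀ r : ℝ, 1 / 2 < r →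
    (fun N => ∑ n ∈ Finset.range N, centered A n) =O[atTop] fun N : ℕ => (N : ℝ) ^ r) :
    ∃ V, IsCenteredSeries A V := by
  have h0 : (0 : ℕ) ∉ A := fun h => by simpa using hA 0 h
  obtain ⟨V, h1, h2⟩ := exists_differentiableOn_tendsto_dirichletSeries (κ := 1 / 2) (by norm_num)
    (y := fun n => (centered A n : ℂ)) (by simp [centered, density_zero, h0]) fun r hr => by
      refine Asymptotics.IsBigO.congr_left (Asymptotics.isBigO_norm_left.1 ?_) fun N => rfl
      refine (hS r hr).norm_left.congr_left fun N => ?_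
      rw [← Complex.ofReal_sum, Complex.norm_real]
  exact ⟨V, h1, h2⟩

lemma tsum_natCast_cpow_eq (hV : IsCenteredSeries A V) {s : ℂ} (hs : 1 < s.re) :
    ∑' n : A, ((n : ℕ) : ℂ) ^ (-s) = V s + densitySeries s := by
  have h1 : HasSum (A.indicator fun n : ℕ => (n : ℂ) ^ (-s)) (∑' n : A, ((n : ℕ) : ℂ) ^ (-s)) :=
    hasSum_subtype_iff_indicator.1 (summable_natCast_cpow_neg A hs).hasSum
  have h2 := (h1.sub (densitySeries_hasSum hs)).tendsto_sum_nat
  have e : ∀ n : ℕ, (centered A n : ℂ) * (n : ℂ) ^ (-s) =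
      A.indicator (fun n : ℕ => (n : ℂ) ^ (-s)) n - (density n : ℂ) * (n : ℂ) ^ (-s) := fun n => by
    classical
    rw [centered, Set.indicator_apply, Set.indicator_apply]
    split_ifs
    · simp
      ring
    · simp
  have h3 := hV.tendsto s (by linarith)
  simp_rw [e] at h3
  linear_combination tendsto_nhds_unique h2 h3

lemma eulerZeta_eq_continuation (hA : ∀ n ∈ A, 2 ≤ n) (hV : IsCenteredSeries A V)
    (hE : ∀ s : ℂ, 1 < s.re → Complex.exp (densitySeries s) = E s / (s - 1)) {s : ℂ}
    (hs : 1 < s.re) : eulerZeta A s = continuation E V A s := by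
  rw [eulerZeta, (hasProd_eulerFactor hA hs).tprod_eq, tsum_natCast_cpow_eq hV hs,
    tsum_natCast_cpow_eq hV (s := 2 * s) (by simp; linarith), continuation, ← hE s hs,
    ← Complex.exp_add]
  congr 1
  ring

lemma isOpen_re_gt (a : ℝ) : IsOpen {s : ℂ | a < s.re} :=
  isOpen_lt continuous_const Complex.continuous_re

lemma differentiableOn_log_continuation (hA : ∀ n ∈ A, 2 ≤ n) (hV : IsCenteredSeries A V) :
    DifferentiableOn ℂ (fun s => V s + (V (2 * s) / 2 + eulerRemainder A s) +
      densitySeries (2 * s) / 2) {s | 1 / 2 < s.re} := by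
  intro s hs
  have hs' : 1 / 2 < s.re := hs
  have h2 : 1 < (2 * s).re := by simp; linarith
  have d2 : DifferentiableAt ℂ (fun s : ℂ => 2 * s) s := differentiableAt_id.const_mul 2
  have hV1 := hV.differentiableOn.differentiableAt ((isOpen_re_gt _).mem_nhds hs)
  have hV2 : DifferentiableAt ℂ (fun s => V (2 * s)) s :=
    (hV.differentiableOn.differentiableAt ((isOpen_re_gt _).mem_nhds
      (show 1 / 2 < (2 * s).re by linarith))).comp s d2
  have hR := (differentiableOn_eulerRemainder hA).differentiableAt ((isOpen_re_gt _).mem_nhds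
    (show 1 / 3 < s.re by linarith))
  have hD : DifferentiableAt ℂ (fun s => densitySeries (2 * s)) s :=
    (differentiableOn_densitySeries.differentiableAt ((isOpen_re_gt _).mem_nhds h2)).comp s d2
  exact ((hV1.add ((hV2.div_const 2).add hR)).add (hD.div_const 2)).differentiableWithinAt

lemma isZetaContinuation_continuation (hA : ∀ n ∈ A, 2 ≤ n) (hV : IsCenteredSeries A V)
    (hEd : Differentiable ℂ E) (hE0 : ∀ s, E s ≠ 0)
    (hE : ∀ s : ℂ, 1 < s.re → Complex.exp (densitySeries s) = E s / (s - 1)) :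
    IsZetaContinuation A (continuation E V A) := by
  set g : ℂ → ℂ := fun s => Complex.exp (V s + (V (2 * s) / 2 + eulerRemainder A s) +
    densitySeries (2 * s) / 2) * E s with hg
  have hgd : AnalyticOnNhd ℂ g {s | 1 / 2 < s.re} :=
    ((differentiableOn_log_continuation hA hV).cexp.mul hEd.differentiableOn).analyticOnNhd
      (isOpen_re_gt _)
  have e : ∀ s, continuation E V A s = (s - 1)⁻¹ * g s := fun s => by
    simp only [continuation, hg]
    ring
  have hg1 : AnalyticAt ℂ g 1 := hgd 1 (by norm_num)
  have hform : ∀ᶠ s in 𝓝[≠] (1 : ℂ), continuation E V A s = (s - 1) ^ (-1 : ℤ) • g s :=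
    Eventually.of_forall fun s => by rw [e, zpow_neg_one, smul_eq_mul]
  have hmero : MeromorphicAt (continuation E V A) 1 :=
    MeromorphicAt.congr (f := fun s => (s - 1) ^ (-1 : ℤ) • g s) (by fun_prop)
      (hform.mono fun s hs => hs.symm)
  refine ⟨fun s hs => (eulerZeta_eq_continuation hA hV hE hs).symm, fun s hs => ?_, hmero, ?_⟩
  · rw [funext e]
    exact ((analyticAt_id.sub analyticAt_const).inv (sub_ne_zero.2 hs.2)).mul (hgd s hs.1)
  · exact (meromorphicOrderAt_eq_int_iff hmero).2
      ⟨g, hg1, mul_ne_zero (Complex.exp_ne_zero _) (hE0 1), hform⟩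

lemma tendsto_add_mul_I (t : ℝ) :
    Tendsto (fun σ : ℝ => (σ : ℂ) + (t : ℂ) * Complex.I) (𝓝[>] (1 / 2))
      (𝓝[{s : ℂ | 1 / 2 < s.re}] (((1 / 2 : ℝ) : ℂ) + (t : ℂ) * Complex.I)) := by
  refine tendsto_nhdsWithin_iff.2 ⟨?_, ?_⟩
  · have : ContinuousAt (fun σ : ℝ => (σ : ℂ) + (t : ℂ) * Complex.I) (1 / 2) := by fun_prop
    exact this.tendsto.mono_left nhdsWithin_le_nhds
  · filter_upwards [self_mem_nhdsWithin] with σ hσ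
    simpa using hσ

/-- Near the critical line the continuation is bounded below by a multiple of `exp (Re V)`: the only
other factor that may fail to be bounded is `exp (densitySeries (2 s) / 2)`, and that one can only
be large. -/
lemma exists_exp_re_le_norm_continuation (hA : ∀ n ∈ A, 2 ≤ n) (hV : IsCenteredSeries A V)
    (hEd : Differentiable ℂ E) (hE0 : ∀ s, E s ≠ 0) (t : ℝ) :
    ∃ C : ℝ, ∀ᶠ σ : ℝ in 𝓝[>] (1 / 2), Real.exp ((V (σ + t * Complex.I)).re + C) ≤
      ‖continuation E V A (σ + t * Complex.I)‖ := by
  set w : ℂ := ((1 / 2 : ℝ) : ℂ) + (t : ℂ) * Complex.I with hw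
  have hwre : w.re = 1 / 2 := by simp [hw]
  have hw1 : w - 1 ≠ 0 := fun h => by
    have := congrArg Complex.re h
    rw [Complex.sub_re, hwre] at this
    norm_num at this
  have hK : ContinuousAt (fun s => (V (2 * s) / 2 + eulerRemainder A s).re) w := by
    have hV2 : ContinuousAt (fun s => V (2 * s)) w :=
      ContinuousAt.comp (g := V) (hV.differentiableOn.differentiableAt ((isOpen_re_gt _).mem_nhds
        (show 1 / 2 < (2 * w).re by simp [hwre]; norm_num))).continuousAt
        (by fun_prop)
    have hR := ((differentiableOn_eulerRemainder hA).differentiableAt ((isOpen_re_gt _).mem_nhds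
      (show 1 / 3 < w.re by rw [hwre]; norm_num))).continuousAt
    exact Complex.continuous_re.continuousAt.comp ((hV2.div_const 2).add hR)
  have hF : ContinuousAt (fun s => ‖E s / (s - 1)‖) w :=
    (hEd.continuous.continuousAt.div (by fun_prop : ContinuousAt (fun s : ℂ => s - 1) w)
      hw1).norm
  have hF0 : 0 < ‖E w / (w - 1)‖ := norm_pos_iff.2 (div_ne_zero (hE0 w) hw1)
  obtain ⟨C, hC⟩ := densitySeries_re_bddBelow (1 + 2 * (t : ℂ) * Complex.I)
  set k : ℝ := (V (2 * w) / 2 + eulerRemainder A w).re with hk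
  refine ⟨k - 1 + C / 2 + Real.log (‖E w / (w - 1)‖ / 2), ?_⟩
  have ht : Tendsto (fun σ : ℝ => (σ : ℂ) + (t : ℂ) * Complex.I) (𝓝[>] (1 / 2)) (𝓝 w) :=
    (tendsto_add_mul_I t).mono_right nhdsWithin_le_nhds
  filter_upwards [ht.eventually (hK.eventually_const_lt (sub_one_lt k)),
    ht.eventually (hF.eventually_const_lt (half_lt_self hF0)),
    (tendsto_two_mul_add_mul_I t).eventually hC] with σ h1 h2 h3
  rw [continuation, norm_mul, Complex.norm_exp, ← add_assoc, Real.exp_add _ (Real.log _),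
    Real.exp_log (half_pos hF0)]
  refine mul_le_mul (Real.exp_le_exp.2 ?_) h2.le (half_pos hF0).le (Real.exp_pos _).le
  rw [Complex.add_re, Complex.add_re (V _), Complex.div_ofNat_re (densitySeries _)]
  linarith

lemma limsup_enorm_continuation_eq_top (hA : ∀ n ∈ A, 2 ≤ n) (hV : IsCenteredSeries A V)
    (hEd : Differentiable ℂ E) (hE0 : ∀ s, E s ≠ 0) (t : ℝ) {σ : ℕ → ℝ}
    (hσ : ∀ k, 1 / 2 < σ k) (hσt : Tendsto σ atTop (𝓝[>] (1 / 2)))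
    (hlarge : ∀ M : ℕ, ∃ᶠ k in atTop, ∃ᶠ N in atTop, (M : ℝ) < ∑ n ∈ Finset.range N,
      ((n : ℂ) ^ (-((σ k : ℂ) + (t : ℂ) * Complex.I))).re * centered A n) :
    limsup (fun σ : ℝ => ‖continuation E V A ((σ : ℂ) + (t : ℂ) * Complex.I)‖ₑ)
      (𝓝[>] (1 / 2 : ℝ)) = ⊤ := by
  have hVlarge : ∀ M : ℕ, ∃ᶠ k in atTop, (M : ℝ) ≤ (V (σ k + t * Complex.I)).re := by
    refine fun M => (hlarge M).mono fun k hk => ?_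
    have h1 := hV.tendsto (σ k + t * Complex.I) (by
      rw [re_add_ofReal_mul_I]
      exact hσ k)
    have h2 := (Complex.continuous_re.tendsto _).comp h1
    refine le_of_not_gt fun hlt => hk ?_
    filter_upwards [h2.eventually_lt_const hlt] with N hN
    refine not_lt.2 (le_of_eq_of_le ?_ hN.le)
    simp only [Function.comp, Complex.re_sum, Complex.re_ofReal_mul]
    exact Finset.sum_congr rfl fun n _ => mul_comm _ _
  obtain ⟨C, hC⟩ := exists_exp_re_le_norm_continuation hA hV hEd hE0 t
  by_contra hne
  obtain ⟨a, ha, hatop⟩ := exists_between (lt_top_iff_ne_top.2 hne)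
  lift a to NNReal using hatop.ne
  have hev := hσt.eventually ((eventually_lt_of_limsup_lt ha).and hC)
  obtain ⟨M, hM⟩ := exists_nat_ge ((a : ℝ) - C)
  obtain ⟨k, hk, h1, h2⟩ := ((hVlarge M).and_eventually hev).exists
  have h3 : ‖continuation E V A (σ k + t * Complex.I)‖ < a := by
    have : ‖continuation E V A (σ k + t * Complex.I)‖₊ < a := by
      rw [← ENNReal.coe_lt_coe]
      exact h1
    exact_mod_cast this
  have h4 := Real.add_one_le_exp ((V (σ k + t * Complex.I)).re + C)
  linarith

/-- A function that is unbounded near a dense set of points of the critical line has no analytic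
continuation through any point of that line. -/
lemma not_exists_analyticAt_of_limsup {F : ℂ → ℂ} (hF : ∀ q : ℚ,
    limsup (fun σ : ℝ => ‖F ((σ : ℂ) + ((q : ℝ) : ℂ) * Complex.I)‖ₑ) (𝓝[>] (1 / 2 : ℝ)) = ⊤)
    {s₀ : ℂ} (hs₀ : s₀.re = 1 / 2) :
    ¬ ∃ g : ℂ → ℂ, AnalyticAt ℂ g s₀ ∧ ∀ᶠ s in 𝓝[{s : ℂ | 1 / 2 < s.re}] s₀, g s = F s := by
  rintro ⟨g, hg, hgF⟩
  have hbd : ∀ᶠ s in 𝓝 s₀, ‖g s‖ < ‖g s₀‖ + 1 :=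
    hg.continuousAt.norm.eventually_lt_const (lt_add_one _)
  obtain ⟨ε, hε, hball⟩ := Metric.eventually_nhds_iff_ball.1
    (hbd.and (eventually_nhdsWithin_iff.1 hgF))
  obtain ⟨q, hq1, hq2⟩ := exists_rat_btwn (show s₀.im < s₀.im + ε by linarith)
  set w : ℂ := ((1 / 2 : ℝ) : ℂ) + ((q : ℝ) : ℂ) * Complex.I with hw
  have hwball : w ∈ Metric.ball s₀ ε := by
    have e : w - s₀ = ((q - s₀.im : ℝ) : ℂ) * Complex.I := by
      apply Complex.ext <;> simp [hw, hs₀]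
    rw [mem_ball_iff_norm, e, norm_mul, Complex.norm_I, mul_one, Complex.norm_real,
      Real.norm_eq_abs, abs_lt]
    constructor <;> linarith
  have hev := (tendsto_add_mul_I q).eventually (eventually_nhdsWithin_iff.2
    ((Metric.isOpen_ball.eventually_mem hwball).mono fun s hs hs2 =>
      (⟨(hball s hs).1, (hball s hs).2 hs2⟩ : ‖g s‖ < ‖g s₀‖ + 1 ∧ g s = F s)))
  have hle : limsup (fun σ : ℝ => ‖F ((σ : ℂ) + ((q : ℝ) : ℂ) * Complex.I)‖ₑ)
      (𝓝[>] (1 / 2 : ℝ)) ≤ ENNReal.ofReal (‖g s₀‖ + 1) := by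
    refine limsup_le_of_le (by isBoundedDefault) (hev.mono fun σ h => ?_)
    rw [← h.2, ← ofReal_norm]
    exact ENNReal.ofReal_le_ofReal h.1.le
  rw [hF q] at hle
  exact ENNReal.ofReal_ne_top (top_le_iff.1 hle)

end Deterministic

end CramerZeta

theorem theorem1 {Ω : Type*} [MeasurableSpace Ω] (P : Measure Ω) [IsProbabilityMeasure P]
    (Q : Ω → Set ℕ) (hQ : IsCramerQuasiPrimes P Q) :
    (∀ᵐ ω ∂P, ∀ s : ℂ, 1 < s.re → Multipliable (fun p : Q ω => eulerFactor s p)) ∧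
    ∃ Z : Ω → ℂ → ℂ,
      (∀ᵐ ω ∂P, IsZetaContinuation (Q ω) (Z ω)) ∧
      (∀ t : ℝ, ∀ᵐ ω ∂P,
        limsup (fun σ : ℝ => ‖Z ω ((σ : ℂ) + (t : ℂ) * Complex.I)‖ₑ) (𝓝[>] (1 / 2 : ℝ)) = ⊤) ∧
      (∀ᵐ ω ∂P, ∀ s₀ : ℂ, s₀.re = 1 / 2 →
        ¬ ∃ g : ℂ → ℂ, AnalyticAt ℂ g s₀ ∧
          ∀ᶠ s in 𝓝[{s : ℂ | 1 / 2 < s.re}] s₀, g s = Z ω s) := by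
  refine ⟨Eventually.of_forall fun ω s hs =>
    (CramerZeta.hasProd_eulerFactor (hQ.two_le ω) hs).multipliable, ?_⟩
  obtain ⟨E, hEd, hE0, hE⟩ := CramerZeta.exists_exp_densitySeries
  have hV : ∀ᵐ ω ∂P, ∃ V, CramerZeta.IsCenteredSeries (Q ω) V := by
    filter_upwards [(CramerZeta.isCenteredBounded_centered hQ).ae_sum_isBigO] with ω hω
    exact CramerZeta.exists_isCenteredSeries (hQ.two_le ω) hω
  -- Outside the almost sure event the value of `V` is irrelevant.
  have hV' : ∀ ω, ∃ V, (∃ V, CramerZeta.IsCenteredSeries (Q ω) V) →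
      CramerZeta.IsCenteredSeries (Q ω) V := fun ω => by
    by_cases h : ∃ V, CramerZeta.IsCenteredSeries (Q ω) V
    · exact ⟨h.choose, fun _ => h.choose_spec⟩
    · exact ⟨0, fun h' => absurd h' h⟩
  choose V hVs using hV'
  set σ : ℕ → ℝ := fun k => 1 / 2 + 1 / ((k : ℝ) + 1) with hσdef
  have hσ : ∀ k, 1 / 2 < σ k := fun k => lt_add_of_pos_right _ (by positivity)
  have hσt : Tendsto σ atTop (𝓝[>] (1 / 2)) := by
    refine tendsto_nhdsWithin_iff.2 ⟨?_, Eventually.of_forall hσ⟩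
    have h := (tendsto_one_div_add_atTop_nhds_zero_nat (𝕜 := ℝ)).const_add (1 / 2)
    rwa [add_zero] at h
  have hlim : ∀ t : ℝ, ∀ᵐ ω ∂P, limsup (fun σ : ℝ =>
      ‖CramerZeta.continuation E (V ω) (Q ω) ((σ : ℂ) + (t : ℂ) * Complex.I)‖ₑ)
      (𝓝[>] (1 / 2 : ℝ)) = ⊤ := by
    intro t
    filter_upwards [hV, CramerZeta.ae_frequently_lt_sum_centered hQ t hσ hσt] with ω h1 h2
    exact CramerZeta.limsup_enorm_continuation_eq_top (hQ.two_le ω) (hVs ω h1) hEd hE0 t hσ hσt h2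
  refine ⟨fun ω => CramerZeta.continuation E (V ω) (Q ω), ?_, hlim, ?_⟩
  · filter_upwards [hV] with ω h1
    exact CramerZeta.isZetaContinuation_continuation (hQ.two_le ω) (hVs ω h1) hEd hE0 hE
  · filter_upwards [ae_all_iff.2 fun q : ℚ => hlim q] with ω hω s₀ hs₀
    exact CramerZeta.not_exists_analyticAt_of_limsup hω hs₀
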